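/- **Conventions.** A *prop* is a strict symmetric monoidal category whose objects are the natural numbers, with tensor product of objects given by addition; a *morphism of props* is a strict symmetric monoidal functor that is the identity on objects. Let $k$ be a field and let $L$ be a set. *Lagrangian affine relations.* Give $(k\oplus k)^n$, with elements $(\phi_i,I_i)_{1\le i\le n}$, the symplectic form $\omega((\phi,I),(\phi',I'))=\sum_i(\phi_iI'_i-\phi'_iI_i)$. For symplectic vector spaces $V,V'$ let $\overline V\oplus V'$ be $V\oplus V'$ with the form $(-\omega_V)\oplus\omega_{V'}$. A *Lagrangian linear relation* $V\nrightarrow V'$ is a Lagrangian (i.e. maximal isotropic) subspace of $\overline V\oplus V'$. A *Lagrangian affine relation* $V\nrightarrow V'$ is a subset of $\overline V\oplus V'$ that is either empty or a translate of a Lagrangian subspace. The Lagrangian linear relations, respectively the Lagrangian affine relations, from $(k\oplus k)^m$ to $(k\oplus k)^n$ are the morphisms $m\to n$ of a prop $\mathrm{LagRel}_k$, respectively $\mathrm{AffLagRel}_k$: composition is that of relations, the tensor product is the direct (cartesian) product of relations, the braiding is $\{(u,v,v,u)\}$. There is an inclusion $\mathrm{LagRel}_k\hookrightarrow\mathrm{AffLagRel}_k$.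 *Circuits.* An *$L$-circuit* from $X$ to $Y$ is a cospan of finite sets $X\to N\leftarrow Y$ together with a finite set $E$ of edges and functions $s,t\colon E\to N$ and $\mathrm{lab}\colon E\to L$. The isomorphism classes of $L$-circuits from $\{1,\dots,m\}$ to $\{1,\dots,n\}$ are the morphisms $m\to n$ of a prop $\mathrm{Circ}_L$: one composes the cospans by pushout and takes the disjoint union of the sets of edges; the tensor product is disjoint union. The circuits with no edges form the prop $\mathrm{FinCospan}$ of isomorphism classes of cospans of finite sets. Each $\ell\in L$ gives a morphism $\ell\colon 1\to1$ of $\mathrm{Circ}_L$: the circuit with two nodes, one of them the input and the other the output, and a single edge, labelled $\ell$, from the input to the output. *Corelations.* $\mathrm{FinCorel}$ is the prop whose morphisms $m\to n$ are the equivalence relations on $\{1,\dots,m\}\sqcup\{1,\dots,n\}$, that is, the isomorphism classes of jointly surjective cospans; one composes and tensors them as cospans and then restricts the apex to the joint image of the legs. The morphism of props $H\colon\mathrm{FinCospan}\to\mathrm{FinCorel}$ restricts the apex of a cospan to the joint image of its legs. The morphism of props $K\colon\mathrm{FinCorel}\to\mathrm{LagRel}_k$ sends a corelation to the relation consisting of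 all families of potentials and currents $(\phi,I)$ at the inputs and outputs such that $\phi$ is constant on each equivalence class and, for each class, the sum of the currents at the inputs in the class equals the sum of the currents at the outputs in it. (So the corelations with one class $m\colon2\to1$, $d\colon1\to2$, $i\colon0\to1$, $e\colon1\to0$ go to $\{\phi_1=\phi_2=\phi_3,\ I_1+I_2=I_3\}$, $\{\phi_1=\phi_2=\phi_3,\ I_1=I_2+I_3\}$, $\{I_2=0\}$, $\{I_1=0\}$.) **Theorem.** For any field $k$, any set $L$, and any choice, for each $\ell\in L$, of a Lagrangian affine relation $\alpha(\ell)$ from $k\oplus k$ to itself, there exists a unique morphism of props $$\blacksquare\colon\mathrm{Circ}_L\to\mathrm{AffLagRel}_k$$ such that the restriction of $\blacksquare$ to $\mathrm{FinCospan}$ is the composite $$\mathrm{FinCospan}\xrightarrow{\ H\ }\mathrm{FinCorel}\xrightarrow{\ K\ }\mathrm{LagRel}_k\hookrightarrow\mathrm{AffLagRel}_k$$ and $\blacksquare(\ell)=\alpha(\ell)$ for every $\ell\in L$. -/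

import Mathlib

universe u v w

namespace Circuits

/-! ### Props -/

/-- The data of a prop: the objects are the natural numbers, the tensor product of objects is
addition; `comp` composes in diagrammatic order. -/
structure PropData where
  Hom : ℕ → ℕ → Type u
  id : ∀ n : ℕ, Hom n n
  comp : ∀ {l m n : ℕ}, Hom l m → Hom m n → Hom l n
  tensor : ∀ {m n m' n' : ℕ}, Hom m n → Hom m' n' → Hom (m + m') (n + n')
  braid : ∀ m n : ℕ, Hom (m + n) (n + m)

/-- Transport of a morphism along equalities of objects. -/
def PropData.castHom (P : PropData.{u}) {m n m' n' : ℕ} (h : m = m') (h' : n = n')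
    (f : P.Hom m n) : P.Hom m' n' :=
  h ▸ h' ▸ f

/-- A prop: a strict symmetric monoidal category whose objects are the natural numbers, with
tensor product of objects given by addition. Strictness means that associators and unitors are
identities, so `tensor` is associative and unital on the nose, up to transport along
`a + b + c = a + (b + c)`, `0 + a = a`, `a + 0 = a`. -/
structure PROP extends PropData.{u} where
  id_comp : ∀ {m n : ℕ} (f : Hom m n), comp (id m) f = f
  comp_id : ∀ {m n : ℕ} (f : Hom m n), comp f (id n) = f
  comp_assoc : ∀ {a b c d : ℕ} (f : Hom a b) (g : Hom b c) (h : Hom c d),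
    comp (comp f g) h = comp f (comp g h)
  tensor_id : ∀ m n : ℕ, tensor (id m) (id n) = id (m + n)
  tensor_comp : ∀ {a b c a' b' c' : ℕ} (f : Hom a b) (g : Hom b c) (f' : Hom a' b')
    (g' : Hom b' c'), tensor (comp f g) (comp f' g') = comp (tensor f f') (tensor g g')
  tensor_assoc : ∀ {a b c a' b' c' : ℕ} (f : Hom a a') (g : Hom b b') (h : Hom c c'),
    toPropData.castHom (add_assoc a b c) (add_assoc a' b' c') (tensor (tensor f g) h) =
      tensor f (tensor g h)
  id_tensor : ∀ {m n : ℕ} (f : Hom m n),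
    toPropData.castHom (zero_add m) (zero_add n) (tensor (id 0) f) = f
  tensor_id_zero : ∀ {m n : ℕ} (f : Hom m n),
    toPropData.castHom (add_zero m) (add_zero n) (tensor f (id 0)) = f
  braid_natural : ∀ {m n m' n' : ℕ} (f : Hom m n) (g : Hom m' n'),
    comp (tensor f g) (braid n n') = comp (braid m m') (tensor g f)
  braid_symm : ∀ m n : ℕ, comp (braid m n) (braid n m) = id (m + n)
  /-- One hexagon identity; the other one follows from it by `braid_symm`. -/
  hexagon : ∀ a b c : ℕ,
    braid a (b + c) =
      comp (toPropData.castHom (add_assoc a b c) (add_assoc b a c)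
          (tensor (braid a b) (id c)))
        (toPropData.castHom rfl (add_assoc b c a).symm (tensor (id b) (braid a c)))

/-- A morphism of props: a strict symmetric monoidal functor that is the identity on objects. -/
@[ext]
structure PROPHom (P : PROP.{u}) (Q : PROP.{v}) where
  map : ∀ {m n : ℕ}, P.Hom m n → Q.Hom m n
  map_id : ∀ n : ℕ, map (P.id n) = Q.id n
  map_comp : ∀ {l m n : ℕ} (f : P.Hom l m) (g : P.Hom m n),
    map (P.comp f g) = Q.comp (map f) (map g)
  map_tensor : ∀ {m n m' n' : ℕ} (f : P.Hom m n) (g : P.Hom m' n'),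
    map (P.tensor f g) = Q.tensor (map f) (map g)
  map_braid : ∀ m n : ℕ, map (P.braid m n) = Q.braid m n

/-- The composite of the morphisms of props `F : P → Q` and `G : Q → R`. -/
def PROPHom.comp {P : PROP.{u}} {Q : PROP.{v}} {R : PROP.{w}}
    (G : PROPHom Q R) (F : PROPHom P Q) : PROPHom P R where
  map f := G.map (F.map f)
  map_id n := by rw [F.map_id, G.map_id]
  map_comp f g := by rw [F.map_comp, G.map_comp]
  map_tensor f g := by rw [F.map_tensor, G.map_tensor]
  map_braid m n := by rw [F.map_braid, G.map_braid]

theorem map_castHom {P : PropData.{u}} {Q : PropData.{v}}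
    (F : ∀ {m n : ℕ}, P.Hom m n → Q.Hom m n) {m n m' n' : ℕ} (h : m = m') (h' : n = n')
    (f : P.Hom m n) : F (P.castHom h h' f) = Q.castHom h h' (F f) := by
  subst h h'; rfl

/-- The laws of a prop pass to an image under maps on morphisms that preserve all operations. -/
def PROP.ofSurjective (P : PROP.{u}) (Q : PropData.{v})
    (F : ∀ {m n : ℕ}, P.Hom m n → Q.Hom m n)
    (hF : ∀ {m n : ℕ}, Function.Surjective (F (m := m) (n := n)))
    (hid : ∀ n : ℕ, F (P.id n) = Q.id n)
    (hcomp : ∀ {l m n : ℕ} (f : P.Hom l m) (g : P.Hom m n),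
      F (P.comp f g) = Q.comp (F f) (F g))
    (htensor : ∀ {m n m' n' : ℕ} (f : P.Hom m n) (g : P.Hom m' n'),
      F (P.tensor f g) = Q.tensor (F f) (F g))
    (hbraid : ∀ m n : ℕ, F (P.braid m n) = Q.braid m n) : PROP.{v} where
  toPropData := Q
  id_comp f := by
    obtain ⟨f, rfl⟩ := hF f
    rw [← hid, ← hcomp, P.id_comp]
  comp_id f := by
    obtain ⟨f, rfl⟩ := hF f
    rw [← hid, ← hcomp, P.comp_id]
  comp_assoc f g h := by
    obtain ⟨f, rfl⟩ := hF f
    obtain ⟨g, rfl⟩ := hF g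
    obtain ⟨h, rfl⟩ := hF h
    simp only [← hcomp, P.comp_assoc]
  tensor_id m n := by simp only [← hid, ← htensor, P.tensor_id]
  tensor_comp f g f' g' := by
    obtain ⟨f, rfl⟩ := hF f
    obtain ⟨g, rfl⟩ := hF g
    obtain ⟨f', rfl⟩ := hF f'
    obtain ⟨g', rfl⟩ := hF g'
    simp only [← hcomp, ← htensor, P.tensor_comp]
  tensor_assoc f g h := by
    obtain ⟨f, rfl⟩ := hF f
    obtain ⟨g, rfl⟩ := hF g
    obtain ⟨h, rfl⟩ := hF h
    simp only [← htensor, ← map_castHom F, P.tensor_assoc]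
  id_tensor f := by
    obtain ⟨f, rfl⟩ := hF f
    simp only [← hid, ← htensor, ← map_castHom F, P.id_tensor]
  tensor_id_zero f := by
    obtain ⟨f, rfl⟩ := hF f
    simp only [← hid, ← htensor, ← map_castHom F, P.tensor_id_zero]
  braid_natural f g := by
    obtain ⟨f, rfl⟩ := hF f
    obtain ⟨g, rfl⟩ := hF g
    simp only [← hbraid, ← htensor, ← hcomp, P.braid_natural]
  braid_symm m n := by simp only [← hbraid, ← hcomp, ← hid, P.braid_symm]
  hexagon a b c := by
    simp only [← hbraid, ← hid, ← htensor, ← map_castHom F, ← hcomp, ← P.hexagon]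

/-- The sub-prop given by a family of morphisms closed under all operations. -/
def PROP.sub (P : PROP.{u}) (p : ∀ {m n : ℕ}, P.Hom m n → Prop)
    (hid : ∀ n : ℕ, p (P.id n))
    (hcomp : ∀ {l m n : ℕ} (f : P.Hom l m) (g : P.Hom m n), p f → p g → p (P.comp f g))
    (htensor : ∀ {m n m' n' : ℕ} (f : P.Hom m n) (g : P.Hom m' n'),
      p f → p g → p (P.tensor f g))
    (hbraid : ∀ m n : ℕ, p (P.braid m n)) : PROP.{u} :=
  let Q : PropData.{u} :=
    { Hom := fun m n => {f : P.Hom m n // p f}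
      id := fun n => ⟨P.id n, hid n⟩
      comp := fun f g => ⟨P.comp f.1 g.1, hcomp _ _ f.2 g.2⟩
      tensor := fun f g => ⟨P.tensor f.1 g.1, htensor _ _ f.2 g.2⟩
      braid := fun m n => ⟨P.braid m n, hbraid m n⟩ }
  have hc : ∀ {m n m' n' : ℕ} (h : m = m') (h' : n = n') (f : Q.Hom m n),
      (Q.castHom h h' f).1 = P.castHom h h' f.1 := fun h h' f =>
    map_castHom (P := Q) (Q := P.toPropData) (fun f => f.1) h h' f
  { Q with
    id_comp := fun _ => Subtype.ext (P.id_comp _)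
    comp_id := fun _ => Subtype.ext (P.comp_id _)
    comp_assoc := fun _ _ _ => Subtype.ext (P.comp_assoc _ _ _)
    tensor_id := fun _ _ => Subtype.ext (P.tensor_id _ _)
    tensor_comp := fun _ _ _ _ => Subtype.ext (P.tensor_comp _ _ _ _)
    tensor_assoc := fun _ _ _ => Subtype.ext ((hc _ _ _).trans (P.tensor_assoc _ _ _))
    id_tensor := fun _ => Subtype.ext ((hc _ _ _).trans (P.id_tensor _))
    tensor_id_zero := fun _ => Subtype.ext ((hc _ _ _).trans (P.tensor_id_zero _))
    braid_natural := fun _ _ => Subtype.ext (P.braid_natural _ _)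
    braid_symm := fun _ _ => Subtype.ext (P.braid_symm _ _)
    hexagon := fun a b c => Subtype.ext ((P.hexagon a b c).trans
      (congrArg₂ P.comp
        (hc (add_assoc a b c) (add_assoc b a c) (Q.tensor (Q.braid a b) (Q.id c))).symm
        (hc rfl (add_assoc b c a).symm (Q.tensor (Q.id b) (Q.braid a c))).symm)) }

/-! ### The prop of relations between powers of a set -/

/-- Relations `X ^ m → X ^ n` with composition of relations, tensored by the cartesian product
`X ^ (m + m') = X ^ m × X ^ m'`. -/
def relData (X : Type u) : PropData.{u} where
  Hom m n := Set ((Fin m → X) × (Fin n → X))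
  id _ := {p | p.1 = p.2}
  comp R S := {p | ∃ v, (p.1, v) ∈ R ∧ (v, p.2) ∈ S}
  tensor {m n m' n'} R S :=
    {p | (fun i => p.1 (Fin.castAdd m' i), fun j => p.2 (Fin.castAdd n' j)) ∈ R ∧
      (fun i => p.1 (Fin.natAdd m i), fun j => p.2 (Fin.natAdd n j)) ∈ S}
  braid m n := {p | (∀ i : Fin m, p.1 (Fin.castAdd n i) = p.2 (Fin.natAdd n i)) ∧
    ∀ j : Fin n, p.1 (Fin.natAdd m j) = p.2 (Fin.castAdd m j)}

theorem relData_castHom {X : Type u} {m n m' n' : ℕ} (h : m = m') (h' : n = n')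
    (R : (relData X).Hom m n) :
    (relData X).castHom h h' R =
      {p : (Fin m' → X) × (Fin n' → X) |
        @Membership.mem _ (Set ((Fin m → X) × (Fin n → X))) _ R
          (fun i => p.1 (Fin.cast h i), fun j => p.2 (Fin.cast h' j))} := by
  subst h h'; rfl

theorem castAdd_castAdd_eq (a b c : ℕ) (i : Fin a) :
    Fin.cast (add_assoc a b c) (Fin.castAdd c (Fin.castAdd b i)) = Fin.castAdd (b + c) i := rfl

theorem castAdd_natAdd_eq (a b c : ℕ) (i : Fin b) :
    Fin.cast (add_assoc a b c) (Fin.castAdd c (Fin.natAdd a i)) =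
      Fin.natAdd a (Fin.castAdd c i) := rfl

theorem natAdd_eq (a b c : ℕ) (i : Fin c) :
    Fin.cast (add_assoc a b c) (Fin.natAdd (a + b) i) =
      Fin.natAdd a (Fin.natAdd b i) := by
  ext; simp [add_assoc]

theorem castAdd_eq' (a b c : ℕ) (i : Fin a) :
    Fin.cast (add_assoc a b c).symm (Fin.castAdd (b + c) i) =
      Fin.castAdd c (Fin.castAdd b i) := rfl

theorem natAdd_castAdd_eq' (a b c : ℕ) (i : Fin b) :
    Fin.cast (add_assoc a b c).symm (Fin.natAdd a (Fin.castAdd c i)) =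
      Fin.castAdd c (Fin.natAdd a i) := rfl

theorem natAdd_natAdd_eq' (a b c : ℕ) (i : Fin c) :
    Fin.cast (add_assoc a b c).symm (Fin.natAdd a (Fin.natAdd b i)) =
      Fin.natAdd (a + b) i := by
  ext; simp [add_assoc]

/-- The prop of sets `X ^ n` and relations. -/
def RelProp (X : Type u) : PROP.{u} where
  toPropData := relData X
  id_comp R := by
    refine Set.ext fun ⟨u, v⟩ => ?_
    exact ⟨fun ⟨_, h, h'⟩ => (show u = _ from h) ▸ h', fun h => ⟨u, rfl, h⟩⟩
  comp_id R := by
    refine Set.ext fun ⟨u, v⟩ => ?_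
    exact ⟨fun ⟨_, h, h'⟩ => (show _ = v from h') ▸ h, fun h => ⟨v, h, rfl⟩⟩
  comp_assoc R S T := by
    refine Set.ext fun ⟨u, v⟩ => ?_
    exact ⟨fun ⟨x, ⟨y, h, h'⟩, h''⟩ => ⟨y, h, x, h', h''⟩,
      fun ⟨y, h, x, h', h''⟩ => ⟨x, ⟨y, h, h'⟩, h''⟩⟩
  tensor_id m n := by
    refine Set.ext fun ⟨u, v⟩ => ?_
    constructor
    · rintro ⟨h, h'⟩
      funext i
      refine Fin.addCases (fun i => ?_) (fun i => ?_) i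
      · exact congrFun h i
      · exact congrFun h' i
    · intro h
      obtain rfl : u = v := h
      exact ⟨rfl, rfl⟩
  tensor_comp {a b c a' b' c'} f g f' g' := by
    refine Set.ext fun ⟨u, v⟩ => ?_
    constructor
    · rintro ⟨⟨x, h, h'⟩, ⟨y, k, k'⟩⟩
      refine ⟨Fin.append x y, ⟨?_, ?_⟩, ⟨?_, ?_⟩⟩ <;> simpa using ‹_›
    · rintro ⟨x, ⟨h, h'⟩, ⟨k, k'⟩⟩
      exact ⟨⟨_, h, k⟩, ⟨_, h', k'⟩⟩
  tensor_assoc {a b c a' b' c'} f g h := by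
    rw [relData_castHom]
    refine Set.ext fun p => ?_
    refine and_assoc.trans (Iff.and Iff.rfl (Iff.and Iff.rfl ?_))
    simp only [natAdd_eq]
  id_tensor f := by
    rw [relData_castHom]
    refine Set.ext fun p => ?_
    refine (and_iff_right ?_).trans ?_
    · exact Subsingleton.elim _ _
    · simp
  tensor_id_zero f := by
    rw [relData_castHom]
    refine Set.ext fun p => ?_
    refine (and_iff_left ?_).trans ?_
    · exact Subsingleton.elim _ _
    · rfl
  braid_natural {m n m' n'} f g := by
    refine Set.ext fun ⟨u, v⟩ => ?_
    constructor
    · rintro ⟨x, ⟨h, h'⟩, k, k'⟩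
      refine ⟨Fin.append (fun i => u (Fin.natAdd _ i)) (fun i => u (Fin.castAdd _ i)),
        ⟨fun i => by simp, fun i => by simp⟩, ?_, ?_⟩
      · rw [show (fun j => x (Fin.natAdd n j)) = fun j => v (Fin.castAdd n j) from
          funext k'] at h'
        simpa using h'
      · rw [show (fun j => x (Fin.castAdd n' j)) = fun j => v (Fin.natAdd n' j) from
          funext k] at h
        simpa using h
    · rintro ⟨x, ⟨h, h'⟩, k, k'⟩
      refine ⟨Fin.append (fun i => v (Fin.natAdd _ i)) (fun i => v (Fin.castAdd _ i)), ⟨?_, ?_⟩,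
        fun i => by simp, fun i => by simp⟩
      · rw [← show (fun j => u (Fin.castAdd m' j)) = fun j => x (Fin.natAdd m' j) from
          funext h] at k'
        simpa using k'
      · rw [← show (fun j => u (Fin.natAdd m j)) = fun j => x (Fin.castAdd m j) from
          funext h'] at k
        simpa using k
  braid_symm m n := by
    refine Set.ext fun ⟨u, v⟩ => ?_
    constructor
    · rintro ⟨x, ⟨h, h'⟩, k, k'⟩
      funext i
      refine Fin.addCases (fun i => ?_) (fun i => ?_) i
      · exact (h i).trans (k' i)
      · exact (h' i).trans (k i)
    · intro h
      obtain rfl : u = v := h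
      exact ⟨Fin.append (fun i => u (Fin.natAdd _ i)) (fun i => u (Fin.castAdd _ i)),
        ⟨fun i => by simp, fun i => by simp⟩, ⟨fun i => by simp, fun i => by simp⟩⟩
  hexagon a b c := by
    rw [relData_castHom, relData_castHom]
    refine Set.ext fun ⟨u, v⟩ => ?_
    constructor
    · rintro ⟨h, h'⟩
      refine ⟨Fin.append (fun i => u (Fin.natAdd _ (Fin.castAdd _ i)))
        (Fin.append (fun i => u (Fin.castAdd _ i))
          (fun i => u (Fin.natAdd _ (Fin.natAdd _ i)))), ⟨⟨?_, ?_⟩, ?_⟩, ⟨?_, ⟨?_, ?_⟩⟩⟩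
      · intro i
        simp [castAdd_castAdd_eq, castAdd_natAdd_eq]
      · intro i
        simp [castAdd_castAdd_eq, castAdd_natAdd_eq]
      · funext i
        simp [natAdd_eq]
      · funext i
        simpa [castAdd_eq'] using h' (Fin.castAdd _ i)
      · intro i
        simpa [natAdd_natAdd_eq'] using h i
      · intro i
        simpa [natAdd_castAdd_eq'] using h' (Fin.natAdd _ i)
    · rintro ⟨x, ⟨⟨h1, h2⟩, h3⟩, ⟨h4, ⟨h5, h6⟩⟩⟩
      constructor
      · intro i
        have e1 := h1 i
        have e2 := h5 i
        simp only [castAdd_castAdd_eq, castAdd_natAdd_eq, natAdd_natAdd_eq'] at e1 e2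
        exact e1.trans e2
      · intro i
        refine Fin.addCases (fun i => ?_) (fun i => ?_) i
        · have e1 := h2 i
          have e2 := congrFun h4 i
          simp only [castAdd_castAdd_eq, castAdd_natAdd_eq, castAdd_eq'] at e1 e2
          exact e1.trans e2
        · have e1 := congrFun h3 i
          have e2 := h6 i
          simp only [natAdd_eq, natAdd_castAdd_eq'] at e1 e2
          exact e1.trans e2

/-! ### Symplectic vector spaces and Lagrangian (affine) relations -/

section Symplectic

variable {k : Type u} [Field k] {V V' V'' : Type v} [AddCommGroup V] [Module k V]
  [AddCommGroup V'] [Module k V'] [AddCommGroup V''] [Module k V'']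

/-- A symplectic structure on a vector space: an alternating nondegenerate bilinear form. -/
structure IsSymplectic (ω : LinearMap.BilinForm k V) : Prop where
  alt : ∀ v, ω v v = 0
  nondeg : ∀ v, (∀ u, ω u v = 0) → v = 0

/-- A subspace on which the form vanishes. -/
def IsIsotropic (ω : LinearMap.BilinForm k V) (W : Submodule k V) : Prop :=
  ∀ v ∈ W, ∀ w ∈ W, ω v w = 0

/-- A Lagrangian subspace: a maximal isotropic subspace. -/
def IsLagrangian (ω : LinearMap.BilinForm k V) (W : Submodule k V) : Prop :=
  Maximal (IsIsotropic ω) W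

/-- The form `(-ω) ⊕ ω'` of the direct sum of the conjugate of `(V, ω)` with `(V', ω')`. -/
def relForm (ω : LinearMap.BilinForm k V) (ω' : LinearMap.BilinForm k V') :
    LinearMap.BilinForm k (V × V') :=
  (-ω).compl₁₂ (LinearMap.fst k V V') (LinearMap.fst k V V') +
    ω'.compl₁₂ (LinearMap.snd k V V') (LinearMap.snd k V V')

@[simp]
theorem relForm_apply (ω : LinearMap.BilinForm k V) (ω' : LinearMap.BilinForm k V')
    (p q : V × V') : relForm ω ω' p q = -ω p.1 q.1 + ω' p.2 q.2 := rfl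

/-- A linear Lagrangian relation from `(V, ω)` to `(V', ω')`: a relation that is a Lagrangian
subspace of the direct sum of the conjugate of `V` with `V'`. -/
def IsLagrangianRel (ω : LinearMap.BilinForm k V) (ω' : LinearMap.BilinForm k V')
    (R : Set (V × V')) : Prop :=
  ∃ W : Submodule k (V × V'), (W : Set (V × V')) = R ∧ IsLagrangian (relForm ω ω') W

/-- A Lagrangian affine relation from `(V, ω)` to `(V', ω')`: a relation that is a (possibly empty)
affine subspace of the direct sum of the conjugate of `V` with `V'`, all of whose tangent spaces
are Lagrangian. The tangent space of an affine subspace at each of its points is its direction. -/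
def IsLagrangianAffineRel (ω : LinearMap.BilinForm k V) (ω' : LinearMap.BilinForm k V')
    (R : Set (V × V')) : Prop :=
  ∃ A : AffineSubspace k (V × V'), (A : Set (V × V')) = R ∧
    ∀ p ∈ A, IsLagrangian (relForm ω ω') A.direction

theorem IsSymplectic.swap {ω : LinearMap.BilinForm k V} (h : IsSymplectic ω) (v w : V) :
    ω v w = -ω w v := by
  have := h.alt (v + w)
  simp only [map_add, LinearMap.add_apply, h.alt, zero_add, add_zero] at this
  exact eq_neg_of_add_eq_zero_right this

theorem IsSymplectic.relForm {ω : LinearMap.BilinForm k V} {ω' : LinearMap.BilinForm k V'}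
    (h : IsSymplectic ω) (h' : IsSymplectic ω') : IsSymplectic (relForm ω ω') where
  alt v := by simp [h.alt, h'.alt]
  nondeg v hv := by
    refine Prod.ext (h.nondeg _ fun u => ?_) (h'.nondeg _ fun u => ?_)
    · simpa using hv (u, 0)
    · simpa using hv (0, u)

theorem IsSymplectic.isLagrangian_iff {ω : LinearMap.BilinForm k V} (h : IsSymplectic ω)
    (W : Submodule k V) : IsLagrangian ω W ↔ ∀ v, v ∈ W ↔ ∀ w ∈ W, ω w v = 0 := by
  constructor
  · intro hW v
    refine ⟨fun hv w hw => hW.1 w hw v hv, fun hv => ?_⟩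
    have hiso : IsIsotropic ω (W ⊔ Submodule.span k {v}) := by
      intro a ha b hb
      obtain ⟨x, hx, y, hy, rfl⟩ := Submodule.mem_sup.1 ha
      obtain ⟨x', hx', y', hy', rfl⟩ := Submodule.mem_sup.1 hb
      obtain ⟨c, rfl⟩ := Submodule.mem_span_singleton.1 hy
      obtain ⟨c', rfl⟩ := Submodule.mem_span_singleton.1 hy'
      simp [hW.1 x hx x' hx', hv x hx, h.alt, h.swap v x', hv x' hx']
    exact hW.2 hiso le_sup_left
      ((le_sup_right : Submodule.span k {v} ≤ _) (Submodule.mem_span_singleton_self v))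
  · intro hW
    refine ⟨fun v hv w hw => (hW w).1 hw v hv, fun W' hW' hle v hv => ?_⟩
    exact (hW v).2 fun w hw => hW' w (hle hw) v hv

/-- A relation is Lagrangian iff it is equal to its symplectic complement. -/
theorem isLagrangianRel_iff {ω : LinearMap.BilinForm k V} {ω' : LinearMap.BilinForm k V'}
    (h : IsSymplectic ω) (h' : IsSymplectic ω') (R : Set (V × V')) :
    IsLagrangianRel ω ω' R ↔ ∀ p, p ∈ R ↔ ∀ q ∈ R, ω q.1 p.1 = ω' q.2 p.2 := by
  have key : ∀ p q : V × V', relForm ω ω' q p = 0 ↔ ω q.1 p.1 = ω' q.2 p.2 := by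
    intro p q
    rw [relForm_apply, neg_add_eq_zero]
  constructor
  · rintro ⟨W, rfl, hW⟩ p
    simpa only [key, SetLike.mem_coe] using ((h.relForm h').isLagrangian_iff W).1 hW p
  · intro hR
    let W : Submodule k (V × V') :=
      { carrier := R
        add_mem' := by
          intro a b ha hb
          rw [hR] at ha hb ⊢
          intro q hq
          simp [ha q hq, hb q hq]
        zero_mem' := by
          rw [hR]
          intro q hq
          simp
        smul_mem' := by
          intro c a ha
          rw [hR] at ha ⊢
          intro q hq
          simp [ha q hq] }
    refine ⟨W, rfl, ((h.relForm h').isLagrangian_iff W).2 fun p => ?_⟩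
    simp only [key]
    exact hR p

theorem IsLagrangianRel.zero_mem {ω : LinearMap.BilinForm k V} {ω' : LinearMap.BilinForm k V'}
    {R : Set (V × V')} (hR : IsLagrangianRel ω ω' R) : (0 : V × V') ∈ R := by
  obtain ⟨W, rfl, -⟩ := hR
  exact W.zero_mem

/-- An inclusion between linear Lagrangian relations is an equality. -/
theorem IsLagrangianRel.eq_of_subset {ω : LinearMap.BilinForm k V}
    {ω' : LinearMap.BilinForm k V'} {R S : Set (V × V')} (hR : IsLagrangianRel ω ω' R)
    (hS : IsLagrangianRel ω ω' S) (h : R ⊆ S) : R = S := by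
  obtain ⟨W, rfl, hW⟩ := hR
  obtain ⟨W', rfl, hW'⟩ := hS
  exact Set.Subset.antisymm h (hW.2 hW'.1 h)

/-- Lagrangian affine relations are empty or translates of linear Lagrangian relations. -/
theorem isLagrangianAffineRel_iff {ω : LinearMap.BilinForm k V} {ω' : LinearMap.BilinForm k V'}
    (R : Set (V × V')) : IsLagrangianAffineRel ω ω' R ↔
      ∀ p ∈ R, ∃ L, IsLagrangianRel ω ω' L ∧ ∀ q, q ∈ R ↔ q - p ∈ L := by
  constructor
  · rintro ⟨A, rfl, hA⟩ p hp
    refine ⟨A.direction, ⟨_, rfl, hA p hp⟩, fun q => ?_⟩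
    exact (AffineSubspace.vsub_right_mem_direction_iff_mem hp q).symm
  · intro hR
    rcases R.eq_empty_or_nonempty with rfl | ⟨p, hp⟩
    · exact ⟨⊥, rfl, fun p hp => hp.elim⟩
    · obtain ⟨L, ⟨W, rfl, hW⟩, hL⟩ := hR p hp
      refine ⟨AffineSubspace.mk' p W, ?_, fun q _ => ?_⟩
      · ext q
        rw [hL q]
        exact AffineSubspace.mem_mk'
      · rwa [AffineSubspace.direction_mk']

theorem IsLagrangianRel.affine {ω : LinearMap.BilinForm k V} {ω' : LinearMap.BilinForm k V'}
    {R : Set (V × V')} (hR : IsLagrangianRel ω ω' R) : IsLagrangianAffineRel ω ω' R := by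
  refine (isLagrangianAffineRel_iff R).2 fun p hp => ⟨R, hR, fun q => ?_⟩
  obtain ⟨W, rfl, -⟩ := hR
  exact (W.sub_mem_iff_left hp).symm

/-- Linear Lagrangian relations are closed under composition. -/
theorem IsLagrangianRel.comp [FiniteDimensional k V] [FiniteDimensional k V']
    [FiniteDimensional k V''] {ω : LinearMap.BilinForm k V} {ω' : LinearMap.BilinForm k V'}
    {ω'' : LinearMap.BilinForm k V''} (h : IsSymplectic ω) (h' : IsSymplectic ω')
    (h'' : IsSymplectic ω'') {R : Set (V × V')} {S : Set (V' × V'')}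
    (hR : IsLagrangianRel ω ω' R) (hS : IsLagrangianRel ω' ω'' S) :
    IsLagrangianRel ω ω'' {p | ∃ v, (p.1, v) ∈ R ∧ (v, p.2) ∈ S} := by
  have hR' := (isLagrangianRel_iff h h' R).1 hR
  have hS' := (isLagrangianRel_iff h' h'' S).1 hS
  refine (isLagrangianRel_iff h h'' _).2 ?_
  rintro ⟨a, c⟩
  constructor
  · rintro ⟨b, hab, hbc⟩ ⟨x, z⟩ ⟨y, hxy, hyz⟩
    exact ((hR' _).1 hab _ hxy).trans ((hS' _).1 hbc _ hyz)
  · intro hac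
    obtain ⟨W, rfl, hW⟩ := hR
    obtain ⟨X, rfl, hX⟩ := hS
    let B : LinearMap.BilinForm k ((V × V') × (V' × V'')) :=
      Circuits.relForm (-Circuits.relForm ω ω') (Circuits.relForm ω' ω'')
    have hBs : IsSymplectic B := by
      refine IsSymplectic.relForm ⟨fun v => ?_, fun v hv => ?_⟩ (h'.relForm h'')
      · simp [h.alt, h'.alt]
      · exact (h.relForm h').nondeg v fun u => neg_eq_zero.1 (hv u)
    have hrefl : B.IsRefl := fun x y hxy => by rw [hBs.swap, hxy, neg_zero]
    have hnd : B.Nondegenerate := by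
      refine ⟨fun x hx => hBs.nondeg x fun y => ?_, fun x hx => hBs.nondeg x hx⟩
      rw [hBs.swap, hx, neg_zero]
    let M : Submodule k ((V × V') × (V' × V'')) := W.prod X
    let D : Submodule k ((V × V') × (V' × V'')) :=
      LinearMap.eqLocus ((LinearMap.snd k V V').comp (LinearMap.fst k _ _))
        ((LinearMap.fst k V' V'').comp (LinearMap.snd k _ _))
    have hM : B.orthogonal M ≤ M := by
      rintro ⟨p, q⟩ hpq
      refine ⟨(hR' p).2 fun r hr => ?_, (hS' q).2 fun r hr => ?_⟩
      · have := hpq (r, 0) ⟨hr, X.zero_mem⟩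
        simpa [B, neg_add_eq_zero, add_neg_eq_zero] using this
      · have := hpq (0, r) ⟨W.zero_mem, hr⟩
        simpa [B, neg_add_eq_zero] using this
    have hD : ∀ p ∈ B.orthogonal D, p.1.1 = 0 ∧ p.2.2 = 0 ∧ p.1.2 = p.2.1 := by
      intro p hp
      refine ⟨h.nondeg _ fun u => ?_, h''.nondeg _ fun u => ?_, ?_⟩
      · have := hp ((u, 0), (0, 0)) rfl
        simpa [B] using this
      · have := hp ((0, 0), (0, u)) rfl
        simpa [B] using this
      · refine sub_eq_zero.1 (h'.nondeg _ fun u => ?_)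
        have := hp ((0, u), (u, 0)) rfl
        simpa [B, ← sub_eq_add_neg] using this
    have hx : (((a, 0), (0, c)) : (V × V') × (V' × V'')) ∈ B.orthogonal (M ⊓ D) := by
      rintro ⟨⟨x, y⟩, ⟨y', z⟩⟩ ⟨⟨hm, hm'⟩, hd⟩
      obtain rfl : y = y' := hd
      have := hac (x, z) ⟨y, hm, hm'⟩
      simp only [] at this
      simp [B, this]
    have hsup : B.orthogonal (M ⊓ D) ≤ M ⊔ B.orthogonal D := by
      rw [← LinearMap.BilinForm.orthogonal_orthogonal hnd hrefl (M ⊔ B.orthogonal D)]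
      refine LinearMap.BilinForm.orthogonal_le (le_inf ?_ ?_)
      · exact (LinearMap.BilinForm.orthogonal_le le_sup_left).trans hM
      · exact (LinearMap.BilinForm.orthogonal_le le_sup_right).trans
          (LinearMap.BilinForm.orthogonal_orthogonal hnd hrefl D).le
    obtain ⟨⟨⟨p1, p2⟩, ⟨p3, p4⟩⟩, ⟨hp, hp'⟩, ⟨⟨q1, q2⟩, ⟨q3, q4⟩⟩, hq, e⟩ :=
      Submodule.mem_sup.1 (hsup hx)
    obtain ⟨h1, h4, h2⟩ := hD _ hq
    simp only [Prod.mk_add_mk, Prod.mk.injEq] at e h1 h4 h2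
    subst h1 h4 h2
    obtain ⟨⟨e1, e2⟩, e3, e4⟩ := e
    rw [add_zero] at e1 e4
    refine ⟨p2, ?_, ?_⟩
    · rw [← e1]
      exact hp
    · rw [← e4, eq_neg_of_add_eq_zero_left e2, ← eq_neg_of_add_eq_zero_left e3]
      exact hp'

end Symplectic

/-! ### The props of linear and affine Lagrangian relations -/

section LagRel

variable (k : Type u) [Field k]

/-- The symplectic structure on `(k ⊕ k) ^ n`, the direct sum of `n` copies of `k ⊕ k` with
`ω ((φ, I), (φ', I')) = φ * I' - φ' * I`. -/
def stdForm (n : ℕ) : LinearMap.BilinForm k (Fin n → k × k) :=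
  LinearMap.mk₂ k (fun u v => ∑ i, ((u i).1 * (v i).2 - (v i).1 * (u i).2))
    (fun a b c => by
      rw [← Finset.sum_add_distrib]
      exact Finset.sum_congr rfl fun i _ => by
        simp only [Pi.add_apply, Prod.fst_add, Prod.snd_add]; ring)
    (fun r a c => by
      rw [Finset.smul_sum]
      exact Finset.sum_congr rfl fun i _ => by
        simp only [Pi.smul_apply, Prod.smul_fst, Prod.smul_snd, smul_eq_mul]; ring)
    (fun a b c => by
      rw [← Finset.sum_add_distrib]
      exact Finset.sum_congr rfl fun i _ => by
        simp only [Pi.add_apply, Prod.fst_add, Prod.snd_add]; ring)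
    (fun r a c => by
      rw [Finset.smul_sum]
      exact Finset.sum_congr rfl fun i _ => by
        simp only [Pi.smul_apply, Prod.smul_fst, Prod.smul_snd, smul_eq_mul]; ring)

theorem stdForm_apply (n : ℕ) (u v : Fin n → k × k) :
    stdForm k n u v = ∑ i, ((u i).1 * (v i).2 - (v i).1 * (u i).2) := rfl

theorem stdForm_symplectic (n : ℕ) : IsSymplectic (stdForm k n) where
  alt v := by simp [stdForm_apply]
  nondeg v hv := by
    funext i
    have h1 := hv (Pi.single i (1, 0))
    have h2 := hv (Pi.single i (0, 1))
    rw [stdForm_apply, Finset.sum_eq_single i (fun j _ hj => by simp [Pi.single_eq_of_ne hj])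
      (by simp)] at h1 h2
    exact Prod.ext (by simpa using h2) (by simpa using h1)

variable {k}

theorem stdForm_add {m n : ℕ} (u v : Fin (m + n) → k × k) :
    stdForm k (m + n) u v =
      stdForm k m (fun i => u (Fin.castAdd n i)) (fun i => v (Fin.castAdd n i)) +
        stdForm k n (fun i => u (Fin.natAdd m i)) (fun i => v (Fin.natAdd m i)) := by
  simp only [stdForm_apply, Fin.sum_univ_add]

/-- The relation `R` from `(k ⊕ k) ^ m` to `(k ⊕ k) ^ n` is a linear Lagrangian relation. -/
abbrev IsLag {m n : ℕ} (R : Set ((Fin m → k × k) × (Fin n → k × k))) : Prop :=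
  IsLagrangianRel (stdForm k m) (stdForm k n) R

/-- The relation `R` from `(k ⊕ k) ^ m` to `(k ⊕ k) ^ n` is a Lagrangian affine relation. -/
abbrev IsAffLag {m n : ℕ} (R : Set ((Fin m → k × k) × (Fin n → k × k))) : Prop :=
  IsLagrangianAffineRel (stdForm k m) (stdForm k n) R

theorem isLag_iff {m n : ℕ} (R : Set ((Fin m → k × k) × (Fin n → k × k))) :
    IsLag R ↔ ∀ p, p ∈ R ↔ ∀ q ∈ R, stdForm k m q.1 p.1 = stdForm k n q.2 p.2 :=
  isLagrangianRel_iff (stdForm_symplectic k m) (stdForm_symplectic k n) R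

theorem isLag_id (n : ℕ) : IsLag ((RelProp (k × k)).id n) := by
  refine (isLag_iff _).2 ?_
  rintro ⟨a, b⟩
  constructor
  · rintro h ⟨c, d⟩ h'
    obtain rfl : a = b := h
    obtain rfl : c = d := h'
    rfl
  · intro h
    refine sub_eq_zero.1 ((stdForm_symplectic k n).nondeg _ fun u => ?_)
    rw [map_sub, sub_eq_zero]
    exact h (u, u) rfl

theorem isLag_comp {l m n : ℕ} (R : (RelProp (k × k)).Hom l m) (S : (RelProp (k × k)).Hom m n)
    (hR : IsLag R) (hS : IsLag S) : IsLag ((RelProp (k × k)).comp R S) :=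
  IsLagrangianRel.comp (stdForm_symplectic k l) (stdForm_symplectic k m)
    (stdForm_symplectic k n) hR hS

theorem append_split {X : Type v} {m n : ℕ} (u : Fin (m + n) → X) :
    Fin.append (fun i => u (Fin.castAdd n i)) (fun i => u (Fin.natAdd m i)) = u := by
  funext i
  refine Fin.addCases (fun i => ?_) (fun i => ?_) i <;> simp

theorem isLag_tensor {m n m' n' : ℕ} (R : Set ((Fin m → k × k) × (Fin n → k × k)))
    (S : Set ((Fin m' → k × k) × (Fin n' → k × k))) (hR : IsLag R) (hS : IsLag S) :
    IsLag ((RelProp (k × k)).tensor (m := m) (n := n) (m' := m') (n' := n') R S) := by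
  refine (isLag_iff _).2 ?_
  rintro ⟨a, b⟩
  have hR' := (isLag_iff _).1 hR
  have hS' := (isLag_iff _).1 hS
  have hz : ∀ (n : ℕ) (v : Fin n → k × k), stdForm k n (fun _ => 0) v = 0 := fun n v => by
    simp [stdForm_apply]
  constructor
  · rintro ⟨h1, h2⟩ ⟨c, d⟩ ⟨h1', h2'⟩
    simp only [stdForm_add]
    exact congrArg₂ _ ((hR' _).1 h1 _ h1') ((hS' _).1 h2 _ h2')
  · intro h
    refine ⟨(hR' _).2 fun q hq => ?_, (hS' _).2 fun q hq => ?_⟩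
    · have hS0 : (fun i => Fin.append q.1 (0 : Fin m' → k × k) (Fin.natAdd m i),
          fun j => Fin.append q.2 (0 : Fin n' → k × k) (Fin.natAdd n j)) ∈ S := by
        simp only [Fin.append_right]
        exact hS.zero_mem
      have := h (Fin.append q.1 (0 : Fin m' → k × k), Fin.append q.2 (0 : Fin n' → k × k))
        ⟨by simpa using hq, hS0⟩
      simpa [stdForm_add, hz] using this
    · have hR0 : (fun i => Fin.append (0 : Fin m → k × k) q.1 (Fin.castAdd m' i),
          fun j => Fin.append (0 : Fin n → k × k) q.2 (Fin.castAdd n' j)) ∈ R := by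
        simp only [Fin.append_left]
        exact hR.zero_mem
      have := h (Fin.append (0 : Fin m → k × k) q.1, Fin.append (0 : Fin n → k × k) q.2)
        ⟨hR0, by simpa using hq⟩
      simpa [stdForm_add, hz] using this

theorem isLag_braid (m n : ℕ) : IsLag ((RelProp (k × k)).braid m n) := by
  have key : ∀ a b c d, (a, b) ∈ (show Set ((Fin (m + n) → k × k) × (Fin (n + m) → k × k)) from
      (RelProp (k × k)).braid m n) → (c, d) ∈
      (show Set ((Fin (m + n) → k × k) × (Fin (n + m) → k × k)) from
        (RelProp (k × k)).braid m n) →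
      stdForm k (m + n) c a = stdForm k (n + m) d b := by
    rintro a b c d ⟨h1, h2⟩ ⟨h1', h2'⟩
    rw [stdForm_add, stdForm_add, add_comm, funext h1, funext h2, funext h1', funext h2']
  refine (isLag_iff _).2 ?_
  rintro ⟨a, b⟩
  constructor
  · rintro h ⟨c, d⟩ h'
    exact key a b c d h h'
  · intro h
    have hu : ∀ {m n : ℕ} (u : Fin (m + n) → k × k), ∃ v : Fin (n + m) → k × k,
        (∀ i : Fin m, u (Fin.castAdd n i) = v (Fin.natAdd n i)) ∧
          ∀ j : Fin n, u (Fin.natAdd m j) = v (Fin.castAdd m j) := fun u =>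
      ⟨Fin.append (fun i => u (Fin.natAdd _ i)) (fun i => u (Fin.castAdd _ i)),
        fun i => by simp, fun i => by simp⟩
    obtain ⟨a', h1, h2⟩ := hu b
    have ha' : (a', b) ∈ (show Set ((Fin (m + n) → k × k) × (Fin (n + m) → k × k)) from
      (RelProp (k × k)).braid m n) := ⟨fun i => (h2 i).symm, fun i => (h1 i).symm⟩
    suffices a = a' by rwa [this]
    refine sub_eq_zero.1 ((stdForm_symplectic k _).nondeg _ fun u => ?_)
    rw [map_sub, sub_eq_zero]
    obtain ⟨v, hv⟩ := hu u
    exact (h (u, v) hv).trans (key a' b u v ha' hv).symm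

/-- The prop whose morphisms `m → n` are the linear Lagrangian relations from `(k ⊕ k) ^ m` to
`(k ⊕ k) ^ n`, with composition of relations and direct sum. -/
def LagRel (k : Type u) [Field k] : PROP.{u} :=
  (RelProp (k × k)).sub (fun R => IsLag R) isLag_id isLag_comp isLag_tensor isLag_braid

theorem isAffLag_comp {l m n : ℕ} (R : (RelProp (k × k)).Hom l m)
    (S : (RelProp (k × k)).Hom m n) (hR : IsAffLag R) (hS : IsAffLag S) :
    IsAffLag ((RelProp (k × k)).comp R S) := by
  refine (isLagrangianAffineRel_iff _).2 ?_
  rintro ⟨a, c⟩ ⟨b, hab, hbc⟩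
  obtain ⟨L, hL, hRL⟩ := (isLagrangianAffineRel_iff _).1 hR _ hab
  obtain ⟨M, hM, hSM⟩ := (isLagrangianAffineRel_iff _).1 hS _ hbc
  refine ⟨_, isLag_comp L M hL hM, ?_⟩
  rintro ⟨x, z⟩
  constructor
  · rintro ⟨y, hxy, hyz⟩
    exact ⟨y - b, (hRL _).1 hxy, (hSM _).1 hyz⟩
  · rintro ⟨y, hxy, hyz⟩
    refine ⟨y + b, (hRL _).2 ?_, (hSM _).2 ?_⟩
    · simpa using hxy
    · simpa using hyz

theorem isAffLag_tensor {m n m' n' : ℕ} (R : (RelProp (k × k)).Hom m n)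
    (S : (RelProp (k × k)).Hom m' n') (hR : IsAffLag R) (hS : IsAffLag S) :
    IsAffLag ((RelProp (k × k)).tensor R S) := by
  refine (isLagrangianAffineRel_iff _).2 ?_
  rintro ⟨a, c⟩ ⟨h, h'⟩
  obtain ⟨L, hL, hRL⟩ := (isLagrangianAffineRel_iff _).1 hR _ h
  obtain ⟨M, hM, hSM⟩ := (isLagrangianAffineRel_iff _).1 hS _ h'
  exact ⟨_, isLag_tensor L M hL hM, fun q => and_congr (hRL _) (hSM _)⟩

/-- The prop whose morphisms `m → n` are the Lagrangian affine relations from `(k ⊕ k) ^ m` to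
`(k ⊕ k) ^ n`, with composition of relations and direct sum. -/
def AffLagRel (k : Type u) [Field k] : PROP.{u} :=
  (RelProp (k × k)).sub (fun R => IsAffLag R) (fun n => (isLag_id n).affine) isAffLag_comp
    isAffLag_tensor (fun m n => (isLag_braid m n).affine)

/-- The inclusion of linear Lagrangian relations into Lagrangian affine relations. -/
def LagRel.toAffLagRel (k : Type u) [Field k] : PROPHom (LagRel k) (AffLagRel k) where
  map R := ⟨R.1, R.2.affine⟩
  map_id _ := rfl
  map_comp _ _ := rfl
  map_tensor _ _ := rfl
  map_braid _ _ := rfl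

end LagRel

/-! ### Cospans and circuits -/

/-- The generating relation of the pushout of `f : Y → A` and `g : Y → B`. -/
inductive PushoutRel {A B Y : Type} (f : Y → A) (g : Y → B) : A ⊕ B → A ⊕ B → Prop
  | glue (y : Y) : PushoutRel f g (Sum.inl (f y)) (Sum.inr (g y))

/-- The pushout of the functions `f : Y → A` and `g : Y → B`: the disjoint union of `A` and `B`
with `f y` and `g y` identified for all `y`. -/
def Pushout {A B Y : Type} (f : Y → A) (g : Y → B) : Type :=
  Quot (PushoutRel f g)

namespace Pushout

variable {A B Y : Type} {f : Y → A} {g : Y → B}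

def inl (f : Y → A) (g : Y → B) (a : A) : Pushout f g := Quot.mk _ (Sum.inl a)

def inr (f : Y → A) (g : Y → B) (b : B) : Pushout f g := Quot.mk _ (Sum.inr b)

theorem glue (f : Y → A) (g : Y → B) (y : Y) : inl f g (f y) = inr f g (g y) :=
  Quot.sound (PushoutRel.glue y)

/-- The function out of the pushout given by the universal property. -/
def desc {C : Type v} (p : A → C) (q : B → C) (h : ∀ y, p (f y) = q (g y)) :
    Pushout f g → C :=
  Quot.lift (Sum.elim p q) (by rintro _ _ ⟨y⟩; exact h y)

@[simp]
theorem desc_inl {C : Type v} (p : A → C) (q : B → C) (h : ∀ y, p (f y) = q (g y)) (a : A) :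
    desc p q h (inl f g a) = p a := rfl

@[simp]
theorem desc_inr {C : Type v} (p : A → C) (q : B → C) (h : ∀ y, p (f y) = q (g y)) (b : B) :
    desc p q h (inr f g b) = q b := rfl

theorem ind {p : Pushout f g → Prop} (hl : ∀ a, p (inl f g a)) (hr : ∀ b, p (inr f g b)) :
    ∀ x, p x := by
  rintro ⟨a | b⟩
  · exact hl a
  · exact hr b

instance [Finite A] [Finite B] : Finite (Pushout f g) := Quot.finite _

end Pushout

/-- A cospan of sets `X → N ← Y` with finite apex `N`. -/
structure Cospan (X Y : Type) : Type 1 where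
  N : Type
  [finN : Finite N]
  inp : X → N
  out : Y → N

/-- An `L`-circuit from `X` to `Y`: a cospan `X → N ← Y` together with a finite graph with set of
nodes `N` and set of edges `E`, whose edges are labelled by elements of `L`. -/
structure Circuit (L : Type u) (X Y : Type) : Type (max 1 u) extends Cospan X Y where
  E : Type
  [finE : Finite E]
  src : E → N
  tgt : E → N
  lab : E → L

attribute [instance] Cospan.finN Circuit.finE

namespace Cospan

variable {X Y Z : Type}

/-- Two cospans are isomorphic if there is a bijection between their apices that commutes with the
legs. -/
def Iso (c d : Cospan X Y) : Prop :=
  ∃ f : c.N ≃ d.N, (∀ x, f (c.inp x) = d.inp x) ∧ ∀ y, f (c.out y) = d.out y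

/-- The cospan `X → X ← Y` given by the identity and a function `g : Y → X`. -/
def ofFun [Finite X] (g : Y → X) : Cospan X Y where
  N := X
  inp := id
  out := g

/-- Composition of cospans by pushout. -/
def comp (c : Cospan X Y) (d : Cospan Y Z) : Cospan X Z where
  N := Pushout c.out d.inp
  inp x := Pushout.inl _ _ (c.inp x)
  out z := Pushout.inr _ _ (d.out z)

/-- The disjoint union of cospans; the set `Fin (m + m')` is identified with the disjoint union of
`Fin m` and `Fin m'`. -/
def tensor {m n m' n' : ℕ} (c : Cospan (Fin m) (Fin n)) (d : Cospan (Fin m') (Fin n')) :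
    Cospan (Fin (m + m')) (Fin (n + n')) where
  N := c.N ⊕ d.N
  inp := Fin.addCases (fun i => Sum.inl (c.inp i)) (fun i => Sum.inr (d.inp i))
  out := Fin.addCases (fun i => Sum.inl (c.out i)) (fun i => Sum.inr (d.out i))

/-- A cospan, seen as a circuit with no edges. -/
def toCircuit (L : Type u) (c : Cospan X Y) : Circuit L X Y where
  toCospan := c
  E := Empty
  src := Empty.elim
  tgt := Empty.elim
  lab := Empty.elim

end Cospan

instance {X Y : Type} (L : Type u) (c : Cospan X Y) : IsEmpty (c.toCircuit L).E :=
  inferInstanceAs (IsEmpty Empty)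

namespace Circuit

variable {L : Type u} {X Y Z W : Type}

/-- Two circuits are isomorphic if there are bijections between their sets of nodes and between
their sets of edges that preserve all the structure. -/
def Iso (c d : Circuit L X Y) : Prop :=
  ∃ (f : c.N ≃ d.N) (g : c.E ≃ d.E), (∀ x, f (c.inp x) = d.inp x) ∧
    (∀ y, f (c.out y) = d.out y) ∧ (∀ e, f (c.src e) = d.src (g e)) ∧
    (∀ e, f (c.tgt e) = d.tgt (g e)) ∧ ∀ e, c.lab e = d.lab (g e)

theorem Iso.refl (c : Circuit L X Y) : Iso c c :=
  ⟨Equiv.refl _, Equiv.refl _, fun _ => rfl, fun _ => rfl, fun _ => rfl, fun _ => rfl,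
    fun _ => rfl⟩

theorem Iso.symm {c d : Circuit L X Y} : Iso c d → Iso d c := by
  rintro ⟨f, g, h1, h2, h3, h4, h5⟩
  refine ⟨f.symm, g.symm, fun x => ?_, fun x => ?_, fun x => ?_, fun x => ?_, fun x => ?_⟩
  · rw [← h1, f.symm_apply_apply]
  · rw [← h2, f.symm_apply_apply]
  · rw [Equiv.symm_apply_eq, h3, g.apply_symm_apply]
  · rw [Equiv.symm_apply_eq, h4, g.apply_symm_apply]
  · rw [h5, g.apply_symm_apply]

theorem Iso.trans {c d e : Circuit L X Y} : Iso c d → Iso d e → Iso c e := by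
  rintro ⟨f, g, h1, h2, h3, h4, h5⟩ ⟨f', g', h1', h2', h3', h4', h5'⟩
  exact ⟨f.trans f', g.trans g', fun x => by simp [h1, h1'], fun x => by simp [h2, h2'],
    fun x => by simp [h3, h3'], fun x => by simp [h4, h4'], fun x => by rw [h5, h5']; rfl⟩

instance setoid (L : Type u) (X Y : Type) : Setoid (Circuit L X Y) where
  r := Iso
  iseqv := ⟨Iso.refl, Iso.symm, Iso.trans⟩

/-- Composition of circuits: the cospans are composed by pushout, the set of edges is the disjoint
union. -/
def comp (c : Circuit L X Y) (d : Circuit L Y Z) : Circuit L X Z where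
  toCospan := c.toCospan.comp d.toCospan
  E := c.E ⊕ d.E
  src := Sum.elim (fun e => Pushout.inl _ _ (c.src e)) (fun e => Pushout.inr _ _ (d.src e))
  tgt := Sum.elim (fun e => Pushout.inl _ _ (c.tgt e)) (fun e => Pushout.inr _ _ (d.tgt e))
  lab := Sum.elim c.lab d.lab

/-- The disjoint union of circuits. -/
def tensor {m n m' n' : ℕ} (c : Circuit L (Fin m) (Fin n)) (d : Circuit L (Fin m') (Fin n')) :
    Circuit L (Fin (m + m')) (Fin (n + n')) where
  toCospan := c.toCospan.tensor d.toCospan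
  E := c.E ⊕ d.E
  src := Sum.map c.src d.src
  tgt := Sum.map c.tgt d.tgt
  lab := Sum.elim c.lab d.lab

/-- The circuit with a single edge, labelled by `ℓ`, from the only input to the only output. -/
def edge (ℓ : L) : Circuit L (Fin 1) (Fin 1) where
  N := Bool
  inp _ := false
  out _ := true
  E := Unit
  src _ := false
  tgt _ := true
  lab _ := ℓ

/-- Precomposition of the legs of a circuit with functions. -/
def reindex {X' Y' : Type} (c : Circuit L X Y) (σ : X' → X) (τ : Y' → Y) : Circuit L X' Y' :=
  { c with
    inp := fun x => c.inp (σ x)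
    out := fun y => c.out (τ y) }

theorem comp_congr {c c' : Circuit L X Y} {d d' : Circuit L Y Z} :
    Iso c c' → Iso d d' → Iso (c.comp d) (c'.comp d') := by
  rintro ⟨f, g, h1, h2, h3, h4, h5⟩ ⟨f', g', h1', h2', h3', h4', h5'⟩
  refine ⟨⟨Pushout.desc (fun a => Pushout.inl _ _ (f a)) (fun b => Pushout.inr _ _ (f' b))
      fun y => ?_,
    Pushout.desc (fun a => Pushout.inl _ _ (f.symm a)) (fun b => Pushout.inr _ _ (f'.symm b))
      fun y => ?_, ?_, ?_⟩, Equiv.sumCongr g g', fun x => ?_, fun x => ?_, ?_, ?_, ?_⟩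
  · rw [h2, h1', Pushout.glue]
  · rw [← h2, ← h1', Equiv.symm_apply_apply, Equiv.symm_apply_apply, Pushout.glue]
  · exact Pushout.ind (fun a => congrArg (Pushout.inl _ _) (f.symm_apply_apply a))
      fun b => congrArg (Pushout.inr _ _) (f'.symm_apply_apply b)
  · exact Pushout.ind (fun a => congrArg (Pushout.inl _ _) (f.apply_symm_apply a))
      fun b => congrArg (Pushout.inr _ _) (f'.apply_symm_apply b)
  · exact congrArg (Pushout.inl c'.out d'.inp) (h1 x)
  · exact congrArg (Pushout.inr c'.out d'.inp) (h2' x)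
  · rintro (e | e)
    · exact congrArg (Pushout.inl c'.out d'.inp) (h3 e)
    · exact congrArg (Pushout.inr c'.out d'.inp) (h3' e)
  · rintro (e | e)
    · exact congrArg (Pushout.inl c'.out d'.inp) (h4 e)
    · exact congrArg (Pushout.inr c'.out d'.inp) (h4' e)
  · rintro (e | e)
    · exact h5 e
    · exact h5' e

theorem tensor_inp_left {m n m' n' : ℕ} (c : Circuit L (Fin m) (Fin n))
    (d : Circuit L (Fin m') (Fin n')) (i : Fin m) :
    (c.tensor d).inp (Fin.castAdd m' i) = Sum.inl (c.inp i) := by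
  simp [tensor, Cospan.tensor]

theorem tensor_inp_right {m n m' n' : ℕ} (c : Circuit L (Fin m) (Fin n))
    (d : Circuit L (Fin m') (Fin n')) (i : Fin m') :
    (c.tensor d).inp (Fin.natAdd m i) = Sum.inr (d.inp i) := by
  simp [tensor, Cospan.tensor]

theorem tensor_out_left {m n m' n' : ℕ} (c : Circuit L (Fin m) (Fin n))
    (d : Circuit L (Fin m') (Fin n')) (i : Fin n) :
    (c.tensor d).out (Fin.castAdd n' i) = Sum.inl (c.out i) := by
  simp [tensor, Cospan.tensor]

theorem tensor_out_right {m n m' n' : ℕ} (c : Circuit L (Fin m) (Fin n))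
    (d : Circuit L (Fin m') (Fin n')) (i : Fin n') :
    (c.tensor d).out (Fin.natAdd n i) = Sum.inr (d.out i) := by
  simp [tensor, Cospan.tensor]

theorem tensor_congr {m n m' n' : ℕ} {c c' : Circuit L (Fin m) (Fin n)}
    {d d' : Circuit L (Fin m') (Fin n')} :
    Iso c c' → Iso d d' → Iso (c.tensor d) (c'.tensor d') := by
  rintro ⟨f, g, h1, h2, h3, h4, h5⟩ ⟨f', g', h1', h2', h3', h4', h5'⟩
  refine ⟨Equiv.sumCongr f f', Equiv.sumCongr g g', fun x => ?_, fun x => ?_, ?_, ?_, ?_⟩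
  · refine Fin.addCases (fun i => ?_) (fun i => ?_) x
    · rw [tensor_inp_left, tensor_inp_left, ← h1]
      rfl
    · rw [tensor_inp_right, tensor_inp_right, ← h1']
      rfl
  · refine Fin.addCases (fun i => ?_) (fun i => ?_) x
    · rw [tensor_out_left, tensor_out_left, ← h2]
      rfl
    · rw [tensor_out_right, tensor_out_right, ← h2']
      rfl
  · rintro (e | e)
    · exact congrArg _ (h3 e)
    · exact congrArg _ (h3' e)
  · rintro (e | e)
    · exact congrArg _ (h4 e)
    · exact congrArg _ (h4' e)
  · rintro (e | e)
    · exact h5 e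
    · exact h5' e

theorem comp_assoc (c : Circuit L X Y) (d : Circuit L Y Z) (e : Circuit L Z W) :
    Iso ((c.comp d).comp e) (c.comp (d.comp e)) := by
  refine ⟨⟨Pushout.desc (Pushout.desc (fun a => Pushout.inl _ _ a)
        (fun b => Pushout.inr _ _ (Pushout.inl _ _ b)) fun y => ?_)
      (fun x => Pushout.inr _ _ (Pushout.inr _ _ x)) fun y => ?_,
    Pushout.desc (fun a => Pushout.inl _ _ (Pushout.inl _ _ a))
      (Pushout.desc (fun b => Pushout.inl _ _ (Pushout.inr _ _ b))
        (fun x => Pushout.inr _ _ x) fun y => ?_) fun y => ?_, ?_, ?_⟩,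
    Equiv.sumAssoc _ _ _, fun x => rfl, fun x => rfl, ?_, ?_, ?_⟩
  · exact Pushout.glue c.out (d.comp e).inp y
  · exact congrArg (Pushout.inr c.out (d.comp e).inp) (Pushout.glue d.out e.inp y)
  · exact Pushout.glue (c.comp d).out e.inp y
  · exact congrArg (Pushout.inl (c.comp d).out e.inp) (Pushout.glue c.out d.inp y)
  · exact Pushout.ind (Pushout.ind (fun _ => rfl) fun _ => rfl) fun _ => rfl
  · exact Pushout.ind (fun _ => rfl) (Pushout.ind (fun _ => rfl) fun _ => rfl)
  · rintro ((e | e) | e) <;> rfl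
  · rintro ((e | e) | e) <;> rfl
  · rintro ((e | e) | e) <;> rfl

theorem tensor_comp {a b c a' b' c' : ℕ} (f : Circuit L (Fin a) (Fin b))
    (g : Circuit L (Fin b) (Fin c)) (f' : Circuit L (Fin a') (Fin b'))
    (g' : Circuit L (Fin b') (Fin c')) :
    Iso ((f.comp g).tensor (f'.comp g')) ((f.tensor f').comp (g.tensor g')) := by
  have hg : ∀ y : Fin b, (Pushout.inl (f.tensor f').out (g.tensor g').inp (Sum.inl (f.out y))) =
      Pushout.inr _ _ (Sum.inl (g.inp y)) := fun y => by
    have := Pushout.glue (f.tensor f').out (g.tensor g').inp (Fin.castAdd b' y)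
    rwa [tensor_out_left, tensor_inp_left] at this
  have hg' : ∀ y : Fin b', (Pushout.inl (f.tensor f').out (g.tensor g').inp
      (Sum.inr (f'.out y))) = Pushout.inr _ _ (Sum.inr (g'.inp y)) := fun y => by
    have := Pushout.glue (f.tensor f').out (g.tensor g').inp (Fin.natAdd b y)
    rwa [tensor_out_right, tensor_inp_right] at this
  refine ⟨⟨Sum.elim (Pushout.desc (fun x => Pushout.inl _ _ (Sum.inl x))
        (fun x => Pushout.inr _ _ (Sum.inl x)) hg)
      (Pushout.desc (fun x => Pushout.inl _ _ (Sum.inr x))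
        (fun x => Pushout.inr _ _ (Sum.inr x)) hg'),
    Pushout.desc (Sum.map (Pushout.inl _ _) (Pushout.inl _ _))
      (Sum.map (Pushout.inr _ _) (Pushout.inr _ _)) ?_, ?_, ?_⟩,
    Equiv.sumSumSumComm _ _ _ _, fun x => ?_, fun x => ?_, ?_, ?_, ?_⟩
  · intro y
    refine Fin.addCases (fun i => ?_) (fun i => ?_) y
    · rw [tensor_out_left, tensor_inp_left]
      exact congrArg Sum.inl (Pushout.glue f.out g.inp i)
    · rw [tensor_out_right, tensor_inp_right]
      exact congrArg Sum.inr (Pushout.glue f'.out g'.inp i)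
  · rintro (x | x)
    · revert x
      exact Pushout.ind (fun _ => rfl) fun _ => rfl
    · revert x
      exact Pushout.ind (fun _ => rfl) fun _ => rfl
  · refine Pushout.ind ?_ ?_ <;> rintro (x | x) <;> rfl
  · refine Fin.addCases (fun i => ?_) (fun i => ?_) x
    · rw [tensor_inp_left]
      exact congrArg (Pushout.inl _ _) (tensor_inp_left f f' i).symm
    · rw [tensor_inp_right]
      exact congrArg (Pushout.inl _ _) (tensor_inp_right f f' i).symm
  · refine Fin.addCases (fun i => ?_) (fun i => ?_) x
    · rw [tensor_out_left]
      exact congrArg (Pushout.inr _ _) (tensor_out_left g g' i).symm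
    · rw [tensor_out_right]
      exact congrArg (Pushout.inr _ _) (tensor_out_right g g' i).symm
  · rintro ((e | e) | (e | e)) <;> rfl
  · rintro ((e | e) | (e | e)) <;> rfl
  · rintro ((e | e) | (e | e)) <;> rfl

/-- The circuit with no edges given by the identity of `X` and a function `g : Y → X`. -/
abbrev ofFun (L : Type u) [Finite X] (g : Y → X) : Circuit L X Y :=
  (Cospan.ofFun g).toCircuit L

theorem comp_ofFun [Finite Y] (c : Circuit L X Y) (g : Z → Y) :
    Iso (c.comp (ofFun L g)) (c.reindex id g) := by
  refine ⟨⟨Pushout.desc id c.out fun y => rfl, Pushout.inl _ _, ?_, fun x => rfl⟩,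
    Equiv.sumEmpty _ _, fun x => rfl, fun x => rfl, ?_, ?_, ?_⟩
  · refine Pushout.ind (fun _ => rfl) fun y => ?_
    exact Pushout.glue c.out (ofFun L g).inp y
  · rintro (e | e)
    · rfl
    · exact e.elim
  · rintro (e | e)
    · rfl
    · exact e.elim
  · rintro (e | e)
    · rfl
    · exact e.elim

theorem ofFun_comp [Finite X] (g : Y ≃ X) (c : Circuit L Y Z) :
    Iso ((ofFun L g).comp c) (c.reindex g.symm id) := by
  refine ⟨⟨Pushout.desc (fun x => c.inp (g.symm x)) id fun y => ?_, Pushout.inr _ _, ?_,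
      fun x => rfl⟩,
    Equiv.emptySum _ _, fun x => rfl, fun x => rfl, ?_, ?_, ?_⟩
  · exact congrArg c.inp (g.symm_apply_apply y)
  · refine Pushout.ind (fun x => ?_) fun _ => rfl
    have := Pushout.glue (ofFun L g).out c.inp (g.symm x)
    refine this.symm.trans (congrArg _ (g.apply_symm_apply x))
  · rintro (e | e)
    · exact e.elim
    · rfl
  · rintro (e | e)
    · exact e.elim
    · rfl
  · rintro (e | e)
    · exact e.elim
    · rfl

theorem reindex_ofFun [Finite X] {X' Y' : Type} [Finite X'] (g : Y → X) (σ : X' ≃ X)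
    (τ : Y' → Y) : Iso ((ofFun L g).reindex σ τ) (ofFun L fun y => σ.symm (g (τ y))) :=
  ⟨σ.symm, Equiv.refl _, fun x => σ.symm_apply_apply x, fun _ => rfl, fun e => e.elim,
    fun e => e.elim, fun e => e.elim⟩

theorem ofFun_tensor {m n m' n' : ℕ} (g : Fin n → Fin m) (h : Fin n' → Fin m') :
    Iso ((ofFun L g).tensor (ofFun L h))
      (ofFun L (Fin.addCases (fun i => Fin.castAdd m' (g i)) fun i => Fin.natAdd m (h i))) := by
  refine ⟨finSumFinEquiv, Equiv.sumEmpty _ _, fun x => ?_, fun x => ?_, fun e => ?_, fun e => ?_,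
    fun e => ?_⟩
  · refine Fin.addCases (fun i => ?_) (fun i => ?_) x
    · rw [tensor_inp_left]
      rfl
    · rw [tensor_inp_right]
      rfl
  · refine Fin.addCases (fun i => ?_) (fun i => ?_) x
    · rw [tensor_out_left]
      change _ = Fin.addCases (motive := fun _ => Fin (m + m')) (fun i => Fin.castAdd m' (g i))
        (fun i => Fin.natAdd m (h i)) (Fin.castAdd n' i)
      rw [Fin.addCases_left]
      rfl
    · rw [tensor_out_right]
      change _ = Fin.addCases (motive := fun _ => Fin (m + m')) (fun i => Fin.castAdd m' (g i))
        (fun i => Fin.natAdd m (h i)) (Fin.natAdd n i)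
      rw [Fin.addCases_right]
      rfl
  · rcases e with e | e <;> exact e.elim
  · rcases e with e | e <;> exact e.elim
  · rcases e with e | e <;> exact e.elim

theorem tensor_assoc {a b c a' b' c' : ℕ} (f : Circuit L (Fin a) (Fin a'))
    (g : Circuit L (Fin b) (Fin b')) (h : Circuit L (Fin c) (Fin c')) :
    Iso (((f.tensor g).tensor h).reindex (finCongr (add_assoc a b c).symm)
      (finCongr (add_assoc a' b' c').symm)) (f.tensor (g.tensor h)) := by
  refine ⟨Equiv.sumAssoc _ _ _, Equiv.sumAssoc _ _ _, fun x => ?_, fun x => ?_, ?_, ?_, ?_⟩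
  · refine Fin.addCases (fun i => ?_) (fun i => Fin.addCases (fun i => ?_) (fun i => ?_) i) x
    · rw [tensor_inp_left]
      change Equiv.sumAssoc _ _ _ (((f.tensor g).tensor h).inp
        (Fin.cast (add_assoc a b c).symm (Fin.castAdd (b + c) i))) = _
      rw [castAdd_eq', tensor_inp_left, tensor_inp_left]
      rfl
    · rw [tensor_inp_right, tensor_inp_left]
      change Equiv.sumAssoc _ _ _ (((f.tensor g).tensor h).inp
        (Fin.cast (add_assoc a b c).symm (Fin.natAdd a (Fin.castAdd c i)))) = _
      rw [natAdd_castAdd_eq', tensor_inp_left, tensor_inp_right]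
      rfl
    · rw [tensor_inp_right, tensor_inp_right]
      change Equiv.sumAssoc _ _ _ (((f.tensor g).tensor h).inp
        (Fin.cast (add_assoc a b c).symm (Fin.natAdd a (Fin.natAdd b i)))) = _
      rw [natAdd_natAdd_eq', tensor_inp_right]
      rfl
  · refine Fin.addCases (fun i => ?_) (fun i => Fin.addCases (fun i => ?_) (fun i => ?_) i) x
    · rw [tensor_out_left]
      change Equiv.sumAssoc _ _ _ (((f.tensor g).tensor h).out
        (Fin.cast (add_assoc a' b' c').symm (Fin.castAdd (b' + c') i))) = _
      rw [castAdd_eq', tensor_out_left, tensor_out_left]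
      rfl
    · rw [tensor_out_right, tensor_out_left]
      change Equiv.sumAssoc _ _ _ (((f.tensor g).tensor h).out
        (Fin.cast (add_assoc a' b' c').symm (Fin.natAdd a' (Fin.castAdd c' i)))) = _
      rw [natAdd_castAdd_eq', tensor_out_left, tensor_out_right]
      rfl
    · rw [tensor_out_right, tensor_out_right]
      change Equiv.sumAssoc _ _ _ (((f.tensor g).tensor h).out
        (Fin.cast (add_assoc a' b' c').symm (Fin.natAdd a' (Fin.natAdd b' i)))) = _
      rw [natAdd_natAdd_eq', tensor_out_right]
      rfl
  · rintro ((e | e) | e) <;> rfl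
  · rintro ((e | e) | e) <;> rfl
  · rintro ((e | e) | e) <;> rfl

theorem id_tensor {m n : ℕ} (c : Circuit L (Fin m) (Fin n)) :
    Iso (((ofFun L (id : Fin 0 → Fin 0)).tensor c).reindex (finCongr (zero_add m).symm)
      (finCongr (zero_add n).symm)) c := by
  refine ⟨Equiv.emptySum (Fin 0) _, Equiv.emptySum Empty _, fun x => ?_, fun x => ?_, ?_, ?_, ?_⟩
  · change Equiv.emptySum (Fin 0) _ (((ofFun L (id : Fin 0 → Fin 0)).tensor c).inp
      (Fin.cast (zero_add m).symm x)) = _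
    rw [← Fin.natAdd_zero, tensor_inp_right]
    rfl
  · change Equiv.emptySum (Fin 0) _ (((ofFun L (id : Fin 0 → Fin 0)).tensor c).out
      (Fin.cast (zero_add n).symm x)) = _
    rw [← Fin.natAdd_zero, tensor_out_right]
    rfl
  · rintro (e | e)
    · exact e.elim
    · rfl
  · rintro (e | e)
    · exact e.elim
    · rfl
  · rintro (e | e)
    · exact e.elim
    · rfl

theorem tensor_id_zero {m n : ℕ} (c : Circuit L (Fin m) (Fin n)) :
    Iso ((c.tensor (ofFun L (id : Fin 0 → Fin 0))).reindex (finCongr (add_zero m).symm)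
      (finCongr (add_zero n).symm)) c := by
  refine ⟨Equiv.sumEmpty _ (Fin 0), Equiv.sumEmpty _ Empty, fun x => ?_, fun x => ?_, ?_, ?_, ?_⟩
  · exact congrArg (Equiv.sumEmpty _ (Fin 0)) (tensor_inp_left c (ofFun L id) x)
  · exact congrArg (Equiv.sumEmpty _ (Fin 0)) (tensor_out_left c (ofFun L id) x)
  · rintro (e | e)
    · rfl
    · exact e.elim
  · rintro (e | e)
    · rfl
    · exact e.elim
  · rintro (e | e)
    · rfl
    · exact e.elim

theorem tensor_comm {m n m' n' : ℕ} (f : Circuit L (Fin m) (Fin n))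
    (g : Circuit L (Fin m') (Fin n')) :
    Iso ((f.tensor g).reindex id (finAddFlip : Fin (n' + n) ≃ Fin (n + n')))
      ((g.tensor f).reindex (finAddFlip : Fin (m' + m) ≃ Fin (m + m')).symm id) := by
  refine ⟨Equiv.sumComm _ _, Equiv.sumComm _ _, fun x => ?_, fun x => ?_, ?_, ?_, ?_⟩
  · refine Fin.addCases (fun i => ?_) (fun i => ?_) x
    · change Equiv.sumComm _ _ ((f.tensor g).inp (Fin.castAdd m' i)) = (g.tensor f).inp
        (finAddFlip (Fin.castAdd m' i))
      rw [finAddFlip_apply_castAdd, tensor_inp_left, tensor_inp_right]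
      rfl
    · change Equiv.sumComm _ _ ((f.tensor g).inp (Fin.natAdd m i)) = (g.tensor f).inp
        (finAddFlip (Fin.natAdd m i))
      rw [finAddFlip_apply_natAdd, tensor_inp_right, tensor_inp_left]
      rfl
  · refine Fin.addCases (fun i => ?_) (fun i => ?_) x
    · change Equiv.sumComm _ _ ((f.tensor g).out (finAddFlip (Fin.castAdd n i))) =
        (g.tensor f).out (Fin.castAdd n i)
      rw [finAddFlip_apply_castAdd, tensor_out_right, tensor_out_left]
      rfl
    · change Equiv.sumComm _ _ ((f.tensor g).out (finAddFlip (Fin.natAdd n' i))) =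
        (g.tensor f).out (Fin.natAdd n' i)
      rw [finAddFlip_apply_natAdd, tensor_out_left, tensor_out_right]
      rfl
  · rintro (e | e) <;> rfl
  · rintro (e | e) <;> rfl
  · rintro (e | e) <;> rfl

end Circuit

/-- Isomorphism classes of `L`-circuits. -/
def circData (L : Type u) : PropData.{max 1 u} where
  Hom m n := Quotient (Circuit.setoid L (Fin m) (Fin n))
  id n := Quotient.mk _ (Circuit.ofFun L (id : Fin n → Fin n))
  comp := Quotient.map₂ Circuit.comp fun _ _ h _ _ h' => Circuit.comp_congr h h'
  tensor := Quotient.map₂ Circuit.tensor fun _ _ h _ _ h' => Circuit.tensor_congr h h'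
  braid m n := Quotient.mk _ (Circuit.ofFun L (finAddFlip : Fin (n + m) ≃ Fin (m + n)))

theorem circData_castHom {L : Type u} {m n m' n' : ℕ} (h : m = m') (h' : n = n')
    (c : Circuit L (Fin m) (Fin n)) :
    (circData L).castHom h h' (Quotient.mk _ c) =
      Quotient.mk _ (c.reindex (finCongr h.symm) (finCongr h'.symm)) := by
  subst h h'; rfl

/-- The prop of isomorphism classes of `L`-circuits. -/
def Circ (L : Type u) : PROP.{max 1 u} where
  toPropData := circData L
  id_comp := by
    rintro m n ⟨c⟩
    exact Quotient.sound (Circuit.ofFun_comp (Equiv.refl _) c)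
  comp_id := by
    rintro m n ⟨c⟩
    exact Quotient.sound (Circuit.comp_ofFun c id)
  comp_assoc := by
    rintro _ _ _ _ ⟨c⟩ ⟨d⟩ ⟨e⟩
    exact Quotient.sound (Circuit.comp_assoc c d e)
  tensor_id m n := by
    refine (Quotient.sound (Circuit.ofFun_tensor id id)).trans ?_
    congr 2
    funext i
    refine Fin.addCases (fun i => ?_) (fun i => ?_) i <;> simp
  tensor_comp := by
    rintro _ _ _ _ _ _ ⟨f⟩ ⟨g⟩ ⟨f'⟩ ⟨g'⟩
    exact Quotient.sound (Circuit.tensor_comp f g f' g')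
  tensor_assoc := by
    rintro a b c a' b' c' ⟨f⟩ ⟨g⟩ ⟨h⟩
    refine (circData_castHom _ _ _).trans (Quotient.sound (Circuit.tensor_assoc f g h))
  id_tensor := by
    rintro m n ⟨c⟩
    refine (circData_castHom _ _ _).trans (Quotient.sound (Circuit.id_tensor c))
  tensor_id_zero := by
    rintro m n ⟨c⟩
    refine (circData_castHom _ _ _).trans (Quotient.sound (Circuit.tensor_id_zero c))
  braid_natural := by
    rintro m n m' n' ⟨f⟩ ⟨g⟩
    exact (Quotient.sound (Circuit.comp_ofFun _ _)).trans
      (Eq.trans (Quotient.sound (Circuit.tensor_comm f g))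
        (Quotient.sound (Circuit.ofFun_comp _ _)).symm)
  braid_symm m n := by
    refine (Quotient.sound (Circuit.comp_ofFun _ _)).trans
      ((Quotient.sound (Circuit.reindex_ofFun _ (Equiv.refl _) _)).trans ?_)
    refine congrArg (fun g => Quotient.mk _ (Circuit.ofFun L g)) (funext fun i => ?_)
    exact finAddFlip.apply_symm_apply i
  hexagon a b c := by
    have h1 := (congrArg ((circData L).castHom (add_assoc a b c) (add_assoc b a c))
      (Quotient.sound (Circuit.ofFun_tensor (L := L) (finAddFlip : Fin (b + a) ≃ Fin (a + b))
        (id : Fin c → Fin c)))).trans ((circData_castHom _ _ _).trans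
          (Quotient.sound (Circuit.reindex_ofFun _ (finCongr (add_assoc a b c).symm) _)))
    have h2 := (congrArg ((circData L).castHom rfl (add_assoc b c a).symm)
      (Quotient.sound (Circuit.ofFun_tensor (L := L) (id : Fin b → Fin b)
        (finAddFlip : Fin (c + a) ≃ Fin (a + c))))).trans ((circData_castHom _ _ _).trans
          (Quotient.sound (Circuit.reindex_ofFun _ (finCongr rfl) _)))
    refine Eq.trans ?_ (congrArg₂ (circData L).comp h1 h2).symm
    refine Eq.trans ?_ ((Quotient.sound (Circuit.comp_ofFun _ _)).trans
      (Quotient.sound (Circuit.reindex_ofFun _ (Equiv.refl _) _))).symm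
    refine congrArg (fun g => Quotient.mk _ (Circuit.ofFun L g)) (funext fun i => ?_)
    refine Fin.addCases (fun i => Fin.addCases (fun i => ?_) (fun i => ?_) i) (fun i => ?_) i
    · simp [natAdd_castAdd_eq', castAdd_castAdd_eq, natAdd_eq]
    · simp [castAdd_eq', castAdd_castAdd_eq, castAdd_natAdd_eq]
    · simp [natAdd_natAdd_eq', castAdd_natAdd_eq, natAdd_eq]

/-- The generating morphism `ℓ : 1 → 1` of `Circ L`: the circuit with a single edge labelled `ℓ`. -/
def Circ.edge {L : Type u} (ℓ : L) : (Circ L).Hom 1 1 :=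
  Quotient.mk _ (Circuit.edge ℓ)

namespace Cospan

variable {X Y Z : Type}

theorem Iso.toCircuit {c d : Cospan X Y} (h : Iso c d) (L : Type u) :
    Circuit.Iso (c.toCircuit L) (d.toCircuit L) := by
  obtain ⟨f, h1, h2⟩ := h
  exact ⟨f, Equiv.refl _, h1, h2, fun e => e.elim, fun e => e.elim, fun e => e.elim⟩

theorem Iso.ofCircuit {L : Type u} {c d : Circuit L X Y} (h : Circuit.Iso c d) :
    Iso c.toCospan d.toCospan := by
  obtain ⟨f, -, h1, h2, -⟩ := h
  exact ⟨f, h1, h2⟩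

instance setoid (X Y : Type) : Setoid (Cospan X Y) where
  r := Iso
  iseqv :=
    ⟨fun c => Iso.ofCircuit (Circuit.Iso.refl (c.toCircuit Empty)),
      fun h => Iso.ofCircuit (h.toCircuit Empty).symm,
      fun h h' => Iso.ofCircuit ((h.toCircuit Empty).trans (h'.toCircuit Empty))⟩

theorem comp_congr {c c' : Cospan X Y} {d d' : Cospan Y Z} (h : Iso c c') (h' : Iso d d') :
    Iso (c.comp d) (c'.comp d') :=
  Iso.ofCircuit (Circuit.comp_congr (h.toCircuit Empty) (h'.toCircuit Empty))

theorem tensor_congr {m n m' n' : ℕ} {c c' : Cospan (Fin m) (Fin n)}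
    {d d' : Cospan (Fin m') (Fin n')} (h : Iso c c') (h' : Iso d d') :
    Iso (c.tensor d) (c'.tensor d') :=
  Iso.ofCircuit (Circuit.tensor_congr (h.toCircuit Empty) (h'.toCircuit Empty))

end Cospan

/-- Isomorphism classes of cospans of finite sets. -/
def finCospanData : PropData.{1} where
  Hom m n := Quotient (Cospan.setoid (Fin m) (Fin n))
  id n := Quotient.mk _ (Cospan.ofFun (id : Fin n → Fin n))
  comp := Quotient.map₂ Cospan.comp fun _ _ h _ _ h' => Cospan.comp_congr h h'
  tensor := Quotient.map₂ Cospan.tensor fun _ _ h _ _ h' => Cospan.tensor_congr h h'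
  braid m n := Quotient.mk _ (Cospan.ofFun (finAddFlip : Fin (n + m) ≃ Fin (m + n)))

/-- The prop of isomorphism classes of cospans of finite sets. Its laws follow from those of
`Circ`, since it is obtained by forgetting the edges of circuits. -/
def FinCospan : PROP.{1} :=
  PROP.ofSurjective (Circ Empty) finCospanData
    (fun {_ _} => Quotient.map Circuit.toCospan fun _ _ h => Cospan.Iso.ofCircuit h)
    (fun {_ _} => by
      rintro ⟨c⟩
      exact ⟨Quotient.mk _ (c.toCircuit Empty), rfl⟩)
    (fun _ => rfl)
    (by
      rintro _ _ _ ⟨c⟩ ⟨d⟩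
      rfl)
    (by
      rintro _ _ _ _ ⟨c⟩ ⟨d⟩
      rfl)
    (fun _ _ => rfl)

/-- The inclusion of cospans of finite sets into circuits, as the circuits with no edges. -/
def FinCospan.toCirc (L : Type u) : PROPHom FinCospan (Circ L) where
  map {_ _} := Quotient.map (Cospan.toCircuit L) fun _ _ h => Cospan.Iso.toCircuit h L
  map_id _ := rfl
  map_comp := by
    rintro _ _ _ ⟨c⟩ ⟨d⟩
    exact Quotient.sound ⟨Equiv.refl _, (Equiv.sumEmpty Empty Empty).symm, fun _ => rfl,
      fun _ => rfl, fun e => e.elim, fun e => e.elim, fun e => e.elim⟩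
  map_tensor := by
    rintro _ _ _ _ ⟨c⟩ ⟨d⟩
    exact Quotient.sound ⟨Equiv.refl _, (Equiv.sumEmpty Empty Empty).symm, fun _ => rfl,
      fun _ => rfl, fun e => e.elim, fun e => e.elim, fun e => e.elim⟩
  map_braid _ _ := rfl

/-! ### Corelations -/

theorem exists_option_of_ker {A B C : Type} {f : A → B} {f' : A → C}
    (h : Setoid.ker f ≤ Setoid.ker f') : ∃ g : B → Option C, ∀ a, g (f a) = some (f' a) :=
  ⟨Function.extend f (fun a => some (f' a)) fun _ => none,
    (show Function.FactorsThrough (fun a => some (f' a)) f from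
      fun _ _ hab => congrArg some (h hab)).extend_apply _⟩

theorem ker_le_of_option {A B C : Type} {f : A → B} {f' : A → C} (g : B → Option C)
    (h : ∀ a, g (f a) = some (f' a)) : Setoid.ker f ≤ Setoid.ker f' := by
  intro a b hab
  have : g (f a) = g (f b) := congrArg g hab
  rw [h, h] at this
  exact Option.some.inj this

namespace Cospan

variable {X Y Z : Type}

/-- The two legs of a cospan `X → N ← Y`, as a function `X ⊕ Y → N`. -/
def legs (c : Cospan X Y) : X ⊕ Y → c.N := Sum.elim c.inp c.out

/-- The corelation of a cospan: the equivalence relation on `X ⊕ Y` that relates the elements with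
the same image in the apex. It describes the cospan with the apex restricted to the joint image of
the two legs. -/
def ker (c : Cospan X Y) : Setoid (X ⊕ Y) := Setoid.ker c.legs

/-- The jointly surjective cospan `X → (X ⊕ Y) / r ← Y` of a corelation `r`. -/
def ofSetoid [Finite X] [Finite Y] (r : Setoid (X ⊕ Y)) : Cospan X Y where
  N := Quotient r
  inp x := Quotient.mk r (Sum.inl x)
  out y := Quotient.mk r (Sum.inr y)

theorem legs_ofSetoid [Finite X] [Finite Y] (r : Setoid (X ⊕ Y)) (a : X ⊕ Y) :
    (ofSetoid r).legs a = Quotient.mk r a := by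
  cases a <;> rfl

theorem ker_ofSetoid [Finite X] [Finite Y] (r : Setoid (X ⊕ Y)) : (ofSetoid r).ker = r := by
  refine Setoid.ext fun a b => ?_
  change (ofSetoid r).legs a = (ofSetoid r).legs b ↔ _
  rw [legs_ofSetoid, legs_ofSetoid]
  exact Quotient.eq

theorem Iso.ker_eq {c d : Cospan X Y} (h : Iso c d) : c.ker = d.ker := by
  obtain ⟨f, h1, h2⟩ := h
  have : ∀ a, f (c.legs a) = d.legs a := by
    rintro (x | y)
    · exact h1 x
    · exact h2 y
  refine Setoid.ext fun a b => ?_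
  change c.legs a = c.legs b ↔ d.legs a = d.legs b
  rw [← this, ← this, f.apply_eq_iff_eq]

theorem ker_comp_le {c c' : Cospan X Y} {d d' : Cospan Y Z} (h : c.ker ≤ c'.ker)
    (h' : d.ker ≤ d'.ker) : (c.comp d).ker ≤ (c'.comp d').ker := by
  obtain ⟨g, hg⟩ := exists_option_of_ker h
  obtain ⟨g', hg'⟩ := exists_option_of_ker h'
  refine ker_le_of_option (Pushout.desc
    (fun a => (g a).map (Pushout.inl c'.out d'.inp))
    (fun b => (g' b).map (Pushout.inr c'.out d'.inp)) fun y => ?_) ?_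
  · have h1 : g (c.out y) = some (c'.out y) := hg (Sum.inr y)
    have h2 : g' (d.inp y) = some (d'.inp y) := hg' (Sum.inl y)
    rw [h1, h2]
    exact congrArg some (Pushout.glue c'.out d'.inp y)
  · rintro (x | z)
    · exact congrArg (Option.map (Pushout.inl c'.out d'.inp)) (hg (Sum.inl x))
    · exact congrArg (Option.map (Pushout.inr c'.out d'.inp)) (hg' (Sum.inr z))

theorem ker_comp_congr {c c' : Cospan X Y} {d d' : Cospan Y Z} (h : c.ker = c'.ker)
    (h' : d.ker = d'.ker) : (c.comp d).ker = (c'.comp d').ker :=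
  le_antisymm (ker_comp_le h.le h'.le) (ker_comp_le h.ge h'.ge)

/-- The decomposition of `Fin (m + m') ⊕ Fin (n + n')` into `Fin m ⊕ Fin n` and
`Fin m' ⊕ Fin n'`. -/
theorem forall_split {m n m' n' : ℕ} {p : Fin (m + m') ⊕ Fin (n + n') → Prop}
    (h : ∀ a : Fin m ⊕ Fin n, p (Sum.map (Fin.castAdd m') (Fin.castAdd n') a))
    (h' : ∀ a : Fin m' ⊕ Fin n', p (Sum.map (Fin.natAdd m) (Fin.natAdd n) a)) : ∀ a, p a := by
  rintro (x | y)
  · exact Fin.addCases (fun i => h (Sum.inl i)) (fun i => h' (Sum.inl i)) x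
  · exact Fin.addCases (fun i => h (Sum.inr i)) (fun i => h' (Sum.inr i)) y

theorem legs_tensor_left {m n m' n' : ℕ} (c : Cospan (Fin m) (Fin n))
    (d : Cospan (Fin m') (Fin n')) (a : Fin m ⊕ Fin n) :
    (c.tensor d).legs (Sum.map (Fin.castAdd m') (Fin.castAdd n') a) = Sum.inl (c.legs a) := by
  cases a <;> simp [legs, tensor]

theorem legs_tensor_right {m n m' n' : ℕ} (c : Cospan (Fin m) (Fin n))
    (d : Cospan (Fin m') (Fin n')) (a : Fin m' ⊕ Fin n') :
    (c.tensor d).legs (Sum.map (Fin.natAdd m) (Fin.natAdd n) a) = Sum.inr (d.legs a) := by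
  cases a <;> simp [legs, tensor]

theorem ker_tensor_le {m n m' n' : ℕ} {c c' : Cospan (Fin m) (Fin n)}
    {d d' : Cospan (Fin m') (Fin n')} (h : c.ker ≤ c'.ker) (h' : d.ker ≤ d'.ker) :
    (c.tensor d).ker ≤ (c'.tensor d').ker := by
  obtain ⟨g, hg⟩ := exists_option_of_ker h
  obtain ⟨g', hg'⟩ := exists_option_of_ker h'
  refine ker_le_of_option
    (Sum.elim (fun a => (g a).map Sum.inl) (fun b => (g' b).map Sum.inr))
    (forall_split (fun a => ?_) fun a => ?_)
  · rw [legs_tensor_left, legs_tensor_left]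
    exact congrArg (Option.map Sum.inl) (hg a)
  · rw [legs_tensor_right, legs_tensor_right]
    exact congrArg (Option.map Sum.inr) (hg' a)

theorem ker_tensor_congr {m n m' n' : ℕ} {c c' : Cospan (Fin m) (Fin n)}
    {d d' : Cospan (Fin m') (Fin n')} (h : c.ker = c'.ker) (h' : d.ker = d'.ker) :
    (c.tensor d).ker = (c'.tensor d').ker :=
  le_antisymm (ker_tensor_le h.le h'.le) (ker_tensor_le h.ge h'.ge)

end Cospan

/-- Corelations of finite sets. A corelation from `Fin m` to `Fin n` is an equivalence relation on
`Fin m ⊕ Fin n`, or equivalently an isomorphism class of jointly surjective cospans. Corelations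
are composed by composing the cospans and restricting the result to its joint image. -/
def finCorelData : PropData.{0} where
  Hom m n := Setoid (Fin m ⊕ Fin n)
  id n := (Cospan.ofFun (id : Fin n → Fin n)).ker
  comp r s := ((Cospan.ofSetoid r).comp (Cospan.ofSetoid s)).ker
  tensor r s := ((Cospan.ofSetoid r).tensor (Cospan.ofSetoid s)).ker
  braid m n := (Cospan.ofFun (finAddFlip : Fin (n + m) ≃ Fin (m + n))).ker

/-- The corelation of an isomorphism class of cospans. -/
def toCorel {m n : ℕ} : FinCospan.Hom m n → finCorelData.Hom m n :=
  Quotient.lift Cospan.ker fun _ _ h => Cospan.Iso.ker_eq h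

theorem toCorel_comp {l m n : ℕ} (f : FinCospan.Hom l m) (g : FinCospan.Hom m n) :
    toCorel (FinCospan.comp f g) = finCorelData.comp (toCorel f) (toCorel g) := by
  obtain ⟨c⟩ := f
  obtain ⟨d⟩ := g
  exact Cospan.ker_comp_congr (Cospan.ker_ofSetoid _).symm (Cospan.ker_ofSetoid _).symm

theorem toCorel_tensor {m n m' n' : ℕ} (f : FinCospan.Hom m n) (g : FinCospan.Hom m' n') :
    toCorel (FinCospan.tensor f g) = finCorelData.tensor (toCorel f) (toCorel g) := by
  obtain ⟨c⟩ := f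
  obtain ⟨d⟩ := g
  exact Cospan.ker_tensor_congr (Cospan.ker_ofSetoid _).symm (Cospan.ker_ofSetoid _).symm

/-- The prop of corelations of finite sets. -/
def FinCorel : PROP.{0} :=
  PROP.ofSurjective FinCospan finCorelData toCorel
    (fun {_ _} r => ⟨Quotient.mk _ (Cospan.ofSetoid r), Cospan.ker_ofSetoid r⟩)
    (fun _ => rfl) toCorel_comp toCorel_tensor (fun _ _ => rfl)

/-- The morphism of props that sends a cospan to the corelation obtained by restricting its apex
to the joint image of its legs. -/
def H : PROPHom FinCospan FinCorel where
  map := toCorel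
  map_id _ := rfl
  map_comp := toCorel_comp
  map_tensor := toCorel_tensor
  map_braid _ _ := rfl

/-! ### The black-boxing of corelations -/

section K

variable {k : Type u} [Field k] {m n : ℕ}

/-- The potential at an input or output. -/
def pot (p : (Fin m → k × k) × (Fin n → k × k)) : Fin m ⊕ Fin n → k :=
  Sum.elim (fun x => (p.1 x).1) (fun y => (p.2 y).1)

open Classical in
/-- The behaviour of a corelation, seen as a collection of ideal wires, one for each class: all
the potentials on a wire are equal, and the sum of the currents flowing in at the inputs on the wire
equals the sum of the currents flowing out at the outputs on it. -/
def kRel (k : Type u) [Field k] {m n : ℕ} (r : Setoid (Fin m ⊕ Fin n)) :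
    Set ((Fin m → k × k) × (Fin n → k × k)) :=
  {p | (∀ a b, r a b → pot p a = pot p b) ∧
    ∀ a, ∑ x with r (Sum.inl x) a, (p.1 x).2 = ∑ y with r (Sum.inr y) a, (p.2 y).2}

theorem sum_classes {r : Setoid (Fin m ⊕ Fin n)} {p : (Fin m → k × k) × (Fin n → k × k)}
    (hp : p ∈ kRel k r) (q : Fin m ⊕ Fin n → k) (hq : ∀ a b, r a b → q a = q b) :
    ∑ x, q (Sum.inl x) * (p.1 x).2 = ∑ y, q (Sum.inr y) * (p.2 y).2 := by
  classical
  have : Fintype (Quotient r) := Fintype.ofFinite _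
  rw [← Finset.sum_fiberwise Finset.univ (fun x => Quotient.mk r (Sum.inl x)),
    ← Finset.sum_fiberwise Finset.univ (fun y => Quotient.mk r (Sum.inr y))]
  refine Finset.sum_congr rfl fun c _ => ?_
  obtain ⟨a, rfl⟩ := Quotient.exists_rep c
  have h := congrArg (q a * ·) (hp.2 a)
  simp only [Finset.mul_sum] at h
  simp only [Quotient.eq]
  convert h using 1
  · refine Finset.sum_congr (by ext; simp) fun x hx => ?_
    rw [hq _ a (Finset.mem_filter.1 hx).2]
  · refine Finset.sum_congr (by ext; simp) fun x hx => ?_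
    rw [hq _ a (Finset.mem_filter.1 hx).2]

theorem mem_kRel_iff {r : Setoid (Fin m ⊕ Fin n)} {p : (Fin m → k × k) × (Fin n → k × k)} :
    p ∈ kRel k r ↔ (∀ a b, r a b → pot p a = pot p b) ∧
      ∀ q : Fin m ⊕ Fin n → k, (∀ a b, r a b → q a = q b) →
        ∑ x, q (Sum.inl x) * (p.1 x).2 = ∑ y, q (Sum.inr y) * (p.2 y).2 := by
  classical
  refine ⟨fun hp => ⟨hp.1, sum_classes hp⟩, fun ⟨h, h'⟩ => ⟨h, fun a => ?_⟩⟩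
  have := h' (fun b => if r b a then 1 else 0) fun b c hbc => by
    have : r b a ↔ r c a := ⟨fun h => r.trans (r.symm hbc) h, fun h => r.trans hbc h⟩
    simp only [this]
  simp only [ite_mul, one_mul, zero_mul] at this
  rw [Finset.sum_filter, Finset.sum_filter]
  convert this

theorem mem_kRel_ker {c : Cospan (Fin m) (Fin n)} {p : (Fin m → k × k) × (Fin n → k × k)} :
    p ∈ kRel k c.ker ↔ (∃ ψ : c.N → k, ∀ a, pot p a = ψ (c.legs a)) ∧
      ∀ q : c.N → k, ∑ x, q (c.inp x) * (p.1 x).2 = ∑ y, q (c.out y) * (p.2 y).2 := by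
  rw [mem_kRel_iff]
  have key : ∀ q : Fin m ⊕ Fin n → k, (∀ a b, c.ker a b → q a = q b) →
      ∃ ψ : c.N → k, ∀ a, q a = ψ (c.legs a) := fun q hq =>
    ⟨Function.extend c.legs q 0, fun a =>
      ((show Function.FactorsThrough q c.legs from fun a b => hq a b).extend_apply 0 a).symm⟩
  constructor
  · rintro ⟨h, h'⟩
    exact ⟨key _ h, fun q => h' (fun a => q (c.legs a)) fun a b hab => congrArg q hab⟩
  · rintro ⟨⟨ψ, h⟩, h'⟩
    refine ⟨fun a b hab => ?_, fun q hq => ?_⟩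
    · rw [h, h]
      exact congrArg ψ hab
    · obtain ⟨ψ', h''⟩ := key q hq
      simp only [h'']
      exact h' ψ'

theorem kRel_isLag (r : Setoid (Fin m ⊕ Fin n)) : IsLag (kRel k r) := by
  classical
  refine (isLag_iff _).2 fun p => ⟨fun hp q hq => ?_, fun h => mem_kRel_iff.2 ⟨?_, ?_⟩⟩
  · have h1 := (mem_kRel_iff.1 hp).2 _ hq.1
    have h2 := (mem_kRel_iff.1 hq).2 _ hp.1
    simp only [stdForm_apply, Finset.sum_sub_distrib]
    exact congrArg₂ _ h1 h2
  · intro a b hab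
    let J : Fin m ⊕ Fin n → k := Pi.single a 1 - Pi.single b 1
    have hJ : ∀ f : Fin m ⊕ Fin n → k, ∑ x, f (Sum.inl x) * J (Sum.inl x) +
        ∑ y, f (Sum.inr y) * J (Sum.inr y) = f a - f b := by
      intro f
      rw [← Fintype.sum_sum_type (fun z => f z * J z)]
      simp [J, mul_sub, Finset.sum_sub_distrib, Pi.single_apply]
    have := h (fun x => (0, J (Sum.inl x)), fun y => (0, -J (Sum.inr y)))
      (mem_kRel_iff.2 ⟨by rintro (_ | _) (_ | _) _ <;> rfl, fun q hq => ?_⟩)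
    · have h2 := hJ (pot p)
      simp only [stdForm_apply, zero_mul, zero_sub, mul_neg, neg_neg,
        Finset.sum_neg_distrib] at this
      refine sub_eq_zero.1 (h2.symm.trans ?_)
      change ∑ x, (p.1 x).1 * J (Sum.inl x) + ∑ y, (p.2 y).1 * J (Sum.inr y) = 0
      rw [← this, add_neg_cancel]
    · have h2 := hJ q
      rw [hq a b hab, sub_self] at h2
      simp only [mul_neg, Finset.sum_neg_distrib]
      exact eq_neg_of_add_eq_zero_left h2
  · intro q hq
    have := h (fun x => (q (Sum.inl x), 0), fun y => (q (Sum.inr y), 0))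
      (mem_kRel_iff.2 ⟨by rintro (_ | _) (_ | _) h <;> exact hq _ _ h, by simp⟩)
    simpa [stdForm_apply] using this

/-- The morphism of props that sends a corelation to its behaviour. -/
def K (k : Type u) [Field k] : PROPHom FinCorel (LagRel k) where
  map r := ⟨kRel k r, kRel_isLag r⟩
  map_id n := by
    refine Subtype.ext (IsLagrangianRel.eq_of_subset (isLag_id n) (kRel_isLag _) ?_).symm
    rintro ⟨u, v⟩ h
    obtain rfl : u = v := h
    exact mem_kRel_ker.2 ⟨⟨fun x => (u x).1, by rintro (x | x) <;> rfl⟩, fun q => rfl⟩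
  map_comp r s := by
    refine Subtype.ext (IsLagrangianRel.eq_of_subset (isLag_comp _ _ (kRel_isLag r)
      (kRel_isLag s)) (kRel_isLag _) ?_).symm
    rintro ⟨u, v⟩ ⟨w, h, h'⟩
    rw [← Cospan.ker_ofSetoid r, mem_kRel_ker] at h
    rw [← Cospan.ker_ofSetoid s, mem_kRel_ker] at h'
    obtain ⟨⟨ψ, h1⟩, h2⟩ := h
    obtain ⟨⟨ψ', h1'⟩, h2'⟩ := h'
    refine mem_kRel_ker.2 ⟨⟨Pushout.desc ψ ψ' fun y => ?_, ?_⟩, fun q => ?_⟩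
    · exact (h1 (Sum.inr y)).symm.trans (h1' (Sum.inl y))
    · rintro (x | y)
      · exact h1 (Sum.inl x)
      · exact h1' (Sum.inr y)
    · refine (h2 fun a => q (Pushout.inl _ _ a)).trans
        (Eq.trans ?_ (h2' fun b => q (Pushout.inr _ _ b)))
      refine Finset.sum_congr rfl fun y _ => ?_
      exact congrArg (fun t => q t * (w y).2) (Pushout.glue _ _ y)
  map_tensor r s := by
    refine Subtype.ext (IsLagrangianRel.eq_of_subset (isLag_tensor _ _ (kRel_isLag r)
      (kRel_isLag s)) (kRel_isLag _) ?_).symm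
    rintro ⟨u, v⟩ ⟨h, h'⟩
    rw [← Cospan.ker_ofSetoid r, mem_kRel_ker] at h
    rw [← Cospan.ker_ofSetoid s, mem_kRel_ker] at h'
    obtain ⟨⟨ψ, h1⟩, h2⟩ := h
    obtain ⟨⟨ψ', h1'⟩, h2'⟩ := h'
    refine mem_kRel_ker.2 ⟨⟨Sum.elim ψ ψ', Cospan.forall_split (fun a => ?_) fun a => ?_⟩,
      fun q => ?_⟩
    · rw [Cospan.legs_tensor_left]
      exact Eq.trans (by cases a <;> rfl) (h1 a)
    · rw [Cospan.legs_tensor_right]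
      exact Eq.trans (by cases a <;> rfl) (h1' a)
    · have := congrArg₂ (· + ·) (h2 fun a => q (Sum.inl a)) (h2' fun a => q (Sum.inr a))
      rw [Fin.sum_univ_add, Fin.sum_univ_add]
      simpa [Cospan.tensor] using this
  map_braid m n := by
    refine Subtype.ext (IsLagrangianRel.eq_of_subset (isLag_braid m n) (kRel_isLag _) ?_).symm
    rintro ⟨u, v⟩ ⟨h, h'⟩
    refine mem_kRel_ker.2 ⟨⟨fun x => (u x).1, ?_⟩, fun q => ?_⟩
    · rintro (x | x)
      · rfl
      · refine Fin.addCases (fun i => ?_) (fun i => ?_) x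
        · change (v (Fin.castAdd m i)).1 = (u (finAddFlip (Fin.castAdd m i))).1
          rw [finAddFlip_apply_castAdd]
          exact congrArg Prod.fst (h' i).symm
        · change (v (Fin.natAdd n i)).1 = (u (finAddFlip (Fin.natAdd n i))).1
          rw [finAddFlip_apply_natAdd]
          exact congrArg Prod.fst (h i).symm
    · have key : ∀ q : Fin (m + n) → k,
          ∑ x, q x * (u x).2 = ∑ y, q (finAddFlip y) * (v y).2 := fun q => by
        rw [Fin.sum_univ_add, Fin.sum_univ_add, add_comm]
        simp only [finAddFlip_apply_castAdd, finAddFlip_apply_natAdd]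
        refine congrArg₂ _ (Finset.sum_congr rfl fun i _ => ?_)
          (Finset.sum_congr rfl fun i _ => ?_)
        · exact congrArg (fun t => q (Fin.natAdd m i) * t) (congrArg Prod.snd (h' i))
        · exact congrArg (fun t => q (Fin.castAdd n i) * t) (congrArg Prod.snd (h i))
      exact key q

/-- The behaviour of the corelation with a single class, for instance of the generators
`m : 2 → 1`, `i : 0 → 1`, `d : 1 → 2`, `e : 1 → 0`. -/
theorem mem_kRel_top {p : (Fin m → k × k) × (Fin n → k × k)} :
    p ∈ kRel k ⊤ ↔ (∀ a b, pot p a = pot p b) ∧ (IsEmpty (Fin m ⊕ Fin n) ∨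
      ∑ x, (p.1 x).2 = ∑ y, (p.2 y).2) := by
  classical
  have h : ∀ a b, (⊤ : Setoid (Fin m ⊕ Fin n)) a b := fun _ _ => trivial
  rcases isEmpty_or_nonempty (Fin m ⊕ Fin n) with h' | h'
  · have := isEmpty_sum.1 h'
    simp [kRel, h, this]
  · have : ¬ IsEmpty (Fin m ⊕ Fin n) := not_isEmpty_iff.2 h'
    simp only [kRel, h, Set.mem_ofPred_eq, Finset.filter_true, forall_const, this, false_or]

/-- The behaviour of multiplication `m`. -/
theorem mem_kRel_mul {p : (Fin 2 → k × k) × (Fin 1 → k × k)} :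
    p ∈ kRel k ⊤ ↔ ((p.1 0).1 = (p.1 1).1 ∧ (p.1 1).1 = (p.2 0).1) ∧
      (p.1 0).2 + (p.1 1).2 = (p.2 0).2 := by
  rw [mem_kRel_top]
  simp [Sum.forall, pot, Fin.forall_fin_two, Fin.sum_univ_two]
  grind

/-- The behaviour of comultiplication `d`. -/
theorem mem_kRel_comul {p : (Fin 1 → k × k) × (Fin 2 → k × k)} :
    p ∈ kRel k ⊤ ↔ ((p.1 0).1 = (p.2 0).1 ∧ (p.2 0).1 = (p.2 1).1) ∧
      (p.1 0).2 = (p.2 0).2 + (p.2 1).2 := by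
  rw [mem_kRel_top]
  simp [Sum.forall, pot, Fin.forall_fin_two, Fin.sum_univ_two]
  grind

/-- The behaviour of the unit `i`. -/
theorem mem_kRel_unit {p : (Fin 0 → k × k) × (Fin 1 → k × k)} :
    p ∈ kRel k ⊤ ↔ (p.2 0).2 = 0 := by
  rw [mem_kRel_top]
  simp [Sum.forall, pot, eq_comm]

/-- The behaviour of the counit `e`. -/
theorem mem_kRel_counit {p : (Fin 1 → k × k) × (Fin 0 → k × k)} :
    p ∈ kRel k ⊤ ↔ (p.1 0).2 = 0 := by
  rw [mem_kRel_top]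
  simp [Sum.forall, pot]

end K

end Circuits

/-! Existence comes from an explicit description of the behaviour of a circuit, as in circuit
theory. A state consists of a potential at every node and, for every edge, an element of the
relation assigned to its label. Potentials must agree where boundary points and edge ends meet
nodes, and Kirchhoff's current law must hold at every node. The behaviour is the set of boundary
potentials and currents that extend to a state.

Kirchhoff's law is used in weak form. Currents placed at points over the nodes define a linear
functional on potentials, called `charge`, and conservation is an equality of such functionals.
Gluing nodes then amounts to restricting the test potentials to those that descend to the pushout.

The main point is `behaviour_comp`. Composing two states is easy: potentials glue, and the currents
on the shared wires cancel. To cut a state of a composite, one has to find currents on the shared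
wires that balance both halves. Conservation on the pushout says that two functionals, one for each
half, agree on the pairs of potentials that match on the wires. These pairs form the kernel of a
linear map. A functional that vanishes on a kernel factors through the map, and the factor is a
functional on potentials on the finite set of wires, hence a family of currents
(`exists_charge_of_pushout`). Products are simpler (`behaviour_tensor`), since nothing is shared.

On a cospan the behaviour is the relation of its corelation (`behaviour_toCircuit`), and on a single
edge it is the prescribed relation (`behaviour_edge`).

Uniqueness rests on generation: any circuit is obtained from cospans and single edges by composition
and tensor product. An edge is peeled off by running every node through as a wire, next to one extra
wire that carries the edge (`Circuit.iso_comp_edge`); induction on the set of edges finishes the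
argument (`Circ.induction`). The same induction shows that behaviours are Lagrangian affine: the
generators are, and such relations are closed under composition and product. -/

namespace Circuits

/-! ### Functionals given by finitely many charges -/

section Charge

variable {k : Type u} [Field k] {X Y Z N N' : Type}

/-- The functional on potentials on `N` given by charges `J y` placed at the points `f y`. -/
noncomputable def charge [Finite Y] (f : Y → N) (J : Y → k) : (N → k) →ₗ[k] k :=
  letI := Fintype.ofFinite Y
  { toFun := fun q => ∑ y, q (f y) * J y
    map_add' := fun p q => by simp [add_mul, Finset.sum_add_distrib]
    map_smul' := fun c q => by simp [mul_assoc, Finset.mul_sum] }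

/-- The definition sums with the `Fintype` structure chosen from `Finite`, since sets of edges are
only known to be finite; the value does not depend on this choice. -/
theorem charge_apply [Fintype Y] (f : Y → N) (J : Y → k) (q : N → k) :
    charge f J q = ∑ y, q (f y) * J y := by
  exact Finset.sum_congr (by ext; simp) fun _ _ => rfl

/-- Pushing charges forward is dual to pulling potentials back. As this holds by definition, the
passage between the nodes of a circuit and those of a composite or a tensor product is often closed
by `rfl` below. -/
theorem charge_comp [Finite Y] (h : N → N') (f : Y → N) (J : Y → k) (q : N' → k) :
    charge (fun y => h (f y)) J q = charge f J (fun a => q (h a)) := rfl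

theorem charge_equiv [Finite Y] [Finite Z] (g : Z ≃ Y) (f : Y → N) (J : Y → k) :
    charge (fun z => f (g z)) (fun z => J (g z)) = charge f J := by
  have := Fintype.ofFinite Y
  have := Fintype.ofFinite Z
  refine LinearMap.ext fun q => ?_
  simp only [charge_apply]
  exact g.sum_comp fun y => q (f y) * J y

/-- Composites and tensor products have the disjoint union of the two sets of edges as edges; this
splits the edge currents accordingly. The version for `Fin (m + n)` does the same for the boundary
of a tensor product. -/
theorem charge_sum [Finite Y] [Finite Z] (f : Y ⊕ Z → N) (J : Y ⊕ Z → k) (q : N → k) :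
    charge f J q = charge (fun y => f (Sum.inl y)) (fun y => J (Sum.inl y)) q +
      charge (fun z => f (Sum.inr z)) (fun z => J (Sum.inr z)) q := by
  have := Fintype.ofFinite Y
  have := Fintype.ofFinite Z
  simp only [charge_apply, Fintype.sum_sum_type]

theorem charge_fin_add {m n : ℕ} (f : Fin (m + n) → N) (J : Fin (m + n) → k) (q : N → k) :
    charge f J q = charge (fun y => f (Fin.castAdd n y)) (fun y => J (Fin.castAdd n y)) q +
      charge (fun z => f (Fin.natAdd m z)) (fun z => J (Fin.natAdd m z)) q := by
  simp only [charge_apply, Fin.sum_univ_add]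

theorem charge_of_isEmpty [IsEmpty Y] (f : Y → N) (J : Y → k) (q : N → k) : charge f J q = 0 := by
  have := Fintype.ofFinite Y
  simp [charge_apply]

/-- Every functional on the potentials on a finite set is given by charges. -/
theorem exists_charge_eq [Finite Y] (F : (Y → k) →ₗ[k] k) : ∃ J : Y → k, F = charge id J := by
  classical
  have := Fintype.ofFinite Y
  -- The charge at `y` is the value of the functional on the indicator of `y`.
  refine ⟨fun y => F (Pi.single y 1), LinearMap.ext fun q => ?_⟩
  rw [charge_apply, F.pi_apply_eq_sum_univ q]
  refine Finset.sum_congr rfl fun y _ => congrArg (q y * F ·) (funext fun z => ?_)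
  simp [Pi.single_apply, eq_comm]

/-- Functionals on the potentials on `A` and `B` that agree on the potentials on the pushout of
`f : Y → A` and `g : Y → B` are given by the same charges on `Y`. -/
theorem exists_charge_of_pushout {A B : Type} [Finite Y] (f : Y → A) (g : Y → B)
    (F : (A → k) →ₗ[k] k) (G : (B → k) →ₗ[k] k)
    (h : ∀ q : Pushout f g → k,
      F (fun a => q (Pushout.inl f g a)) = G (fun b => q (Pushout.inr f g b))) :
    ∃ J : Y → k, F = charge f J ∧ G = charge g J := by
  -- `T (p, q) = p ∘ f - q ∘ g`, so the kernel of `T` consists of the pairs that glue to a potential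
  -- on the pushout.
  let T : (A → k) × (B → k) →ₗ[k] (Y → k) :=
    (LinearMap.funLeft k k f).coprod (-LinearMap.funLeft k k g)
  -- Over a field the range of the transpose is the annihilator of the kernel, in any dimension; so
  -- `A` and `B` need not be finite, and it suffices to check that `(F, -G)` vanishes on the kernel
  -- of `T`. There the hypothesis applies to the glued potential.
  have hmem : F.coprod (-G) ∈ LinearMap.range T.dualMap := by
    rw [LinearMap.range_dualMap_eq_dualAnnihilator_ker, Submodule.mem_dualAnnihilator]
    rintro ⟨p, q⟩ hpq
    have e : ∀ y, p (f y) = q (g y) := fun y => by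
      have := congrFun (LinearMap.mem_ker.1 hpq) y
      simpa [T, LinearMap.funLeft_apply, add_neg_eq_zero] using this
    have := h (Pushout.desc p q e)
    simpa [add_neg_eq_zero] using this
  -- Now `F p - G q = D (p ∘ f - q ∘ g)`, with `D` given by charges `J` because `Y` is finite.
  -- Setting `q = 0` yields `F`, and setting `p = 0` yields `G`, where the two signs cancel.
  obtain ⟨D, hD⟩ := hmem
  obtain ⟨J, rfl⟩ := exists_charge_eq D
  have hz : charge id J (fun _ => (0 : k)) = 0 := map_zero _
  refine ⟨J, LinearMap.ext fun p => ?_, LinearMap.ext fun q => ?_⟩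
  · have := LinearMap.congr_fun hD (p, 0)
    rw [LinearMap.dualMap_apply] at this
    simpa [T, LinearMap.funLeft, Function.comp_def, ← charge_comp, hz] using this.symm
  · have := LinearMap.congr_fun hD (0, q)
    rw [LinearMap.dualMap_apply] at this
    simpa [T, LinearMap.funLeft, Function.comp_def, ← charge_comp, hz] using this.symm

end Charge

/-! ### The behaviour of a circuit -/

section Behaviour

variable {k : Type u} [Field k] {L : Type v} {l m n m' n' : ℕ}
  (α : L → Set ((Fin 1 → k × k) × (Fin 1 → k × k)))

/-- The potentials `ψ` at the nodes, the states `w` of the edges and the potentials and currents `p`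
at the inputs and outputs form a state of the circuit `c`: potentials agree where things are
attached, each edge satisfies its law, and currents are conserved at the nodes. -/
structure IsState (c : Circuit L (Fin m) (Fin n)) (ψ : c.N → k)
    (w : c.E → (Fin 1 → k × k) × (Fin 1 → k × k))
    (p : (Fin m → k × k) × (Fin n → k × k)) : Prop where
  inp : ∀ x, (p.1 x).1 = ψ (c.inp x)
  out : ∀ y, (p.2 y).1 = ψ (c.out y)
  law : ∀ e, w e ∈ α (c.lab e)
  src : ∀ e, ((w e).1 0).1 = ψ (c.src e)
  tgt : ∀ e, ((w e).2 0).1 = ψ (c.tgt e)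
  -- Weak form of Kirchhoff's current law: with `q` the indicator of a node, the current arriving
  -- there from inputs and from edges that end there equals the current leaving through outputs and
  -- edges that start there. The currents at the two ends of an edge are separate and are related
  -- only by its law.
  conserved : ∀ q : c.N → k,
    charge c.inp (fun x => (p.1 x).2) q + charge c.tgt (fun e => ((w e).2 0).2) q =
      charge c.out (fun y => (p.2 y).2) q + charge c.src (fun e => ((w e).1 0).2) q

/-- The potentials and currents at the inputs and outputs that extend to a state of the circuit. -/
def behaviour (c : Circuit L (Fin m) (Fin n)) : Set ((Fin m → k × k) × (Fin n → k × k)) :=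
  {p | ∃ ψ w, IsState α c ψ w p}

variable {α}

theorem IsState.of_iso {c d : Circuit L (Fin m) (Fin n)} (f : c.N ≃ d.N) (g : c.E ≃ d.E)
    (h1 : ∀ x, f (c.inp x) = d.inp x) (h2 : ∀ y, f (c.out y) = d.out y)
    (h3 : ∀ e, f (c.src e) = d.src (g e)) (h4 : ∀ e, f (c.tgt e) = d.tgt (g e))
    (h5 : ∀ e, c.lab e = d.lab (g e)) {ψ : d.N → k} {w : d.E → _} {p}
    (hp : IsState α d ψ w p) : IsState α c (fun a => ψ (f a)) (fun e => w (g e)) p where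
  inp x := by rw [h1, hp.inp]
  out y := by rw [h2, hp.out]
  law e := by rw [h5]; exact hp.law _
  src e := by rw [h3, hp.src]
  tgt e := by rw [h4, hp.tgt]
  conserved q := by
    have hq : (fun a => q (f.symm (f a))) = q := by simp
    -- The law for `d` is tested against `q` carried over by the bijection of nodes; `charge_equiv`
    -- then reindexes the sums over edges, and the compatibilities replace the structure maps of `d`
    -- by those of `c`.
    have key := hp.conserved fun b => q (f.symm b)
    rw [← charge_equiv g d.tgt, ← charge_equiv g d.src, ← funext h1, ← funext h2, ← funext h3,
      ← funext h4] at key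
    rw [← hq]
    exact key

theorem behaviour_congr {c d : Circuit L (Fin m) (Fin n)} (h : Circuit.Iso c d) :
    behaviour α c = behaviour α d := by
  have key : ∀ {c d : Circuit L (Fin m) (Fin n)}, Circuit.Iso c d →
      behaviour α d ⊆ behaviour α c := by
    rintro c d ⟨f, g, h1, h2, h3, h4, h5⟩ p ⟨ψ, w, hp⟩
    exact ⟨_, _, hp.of_iso f g h1 h2 h3 h4 h5⟩
  exact Set.Subset.antisymm (key h.symm) (key h)

/-! ### Behaviour and composition -/

/-- A test potential on the pushout enters only through its restrictions to the two sets of nodes.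
Inputs lie over the first, outputs over the second, and edges split by `charge_sum`; the shared
boundary contributes no term of its own. -/
theorem conserved_comp_iff (c : Circuit L (Fin l) (Fin m)) (d : Circuit L (Fin m) (Fin n))
    (u : Fin l → k × k) (v : Fin n → k × k)
    (w : (c.comp d).E → (Fin 1 → k × k) × (Fin 1 → k × k)) (q : (c.comp d).N → k) :
    charge (c.comp d).inp (fun x => (u x).2) q +
        charge (c.comp d).tgt (fun e => ((w e).2 0).2) q =
      charge (c.comp d).out (fun y => (v y).2) q +
        charge (c.comp d).src (fun e => ((w e).1 0).2) q ↔
    charge c.inp (fun x => (u x).2) (fun a => q (Pushout.inl _ _ a)) +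
        (charge c.tgt (fun e => ((w (Sum.inl e)).2 0).2) (fun a => q (Pushout.inl _ _ a)) +
          charge d.tgt (fun e => ((w (Sum.inr e)).2 0).2) (fun a => q (Pushout.inr _ _ a))) =
      charge d.out (fun x => (v x).2) (fun a => q (Pushout.inr _ _ a)) +
        (charge c.src (fun e => ((w (Sum.inl e)).1 0).2) (fun a => q (Pushout.inl _ _ a)) +
          charge d.src (fun e => ((w (Sum.inr e)).1 0).2) (fun a => q (Pushout.inr _ _ a))) :=
  Iff.of_eq (congrArg₂ Eq (congrArg₂ (· + ·) rfl (charge_sum _ _ q))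
    (congrArg₂ (· + ·) rfl (charge_sum _ _ q)))

/-- One inclusion cuts a state along the shared wires, whose currents are supplied by
`exists_charge_of_pushout`; the other glues two states that agree on the wires, whose currents then
cancel in the sum of the two conservation laws. -/
theorem behaviour_comp (c : Circuit L (Fin l) (Fin m)) (d : Circuit L (Fin m) (Fin n)) :
    behaviour α (c.comp d) = (RelProp (k × k)).comp (behaviour α c) (behaviour α d) := by
  ext ⟨u, v⟩
  constructor
  · rintro ⟨ψ, w, h⟩
    -- The first functional is the net current that inputs and edges bring to the nodes of `c`, and
    -- so must leave through the wires; the second is the net current that outputs and edges draw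
    -- from the nodes of `d`, and so must arrive through the wires. Conservation in the composite
    -- says that they agree on potentials on the pushout.
    obtain ⟨J, hJ, hJ'⟩ := exists_charge_of_pushout c.out d.inp
      (charge c.inp (fun x => (u x).2) + charge c.tgt (fun e => ((w (Sum.inl e)).2 0).2) -
        charge c.src (fun e => ((w (Sum.inl e)).1 0).2))
      (charge d.out (fun x => (v x).2) + charge d.src (fun e => ((w (Sum.inr e)).1 0).2) -
        charge d.tgt (fun e => ((w (Sum.inr e)).2 0).2)) fun q => by
        have := (conserved_comp_iff c d u v w q).1 (h.conserved q)
        simp only [LinearMap.sub_apply, LinearMap.add_apply]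
        linear_combination this
    refine ⟨fun y => (ψ (Pushout.inl _ _ (c.out y)), J y),
      ⟨fun a => ψ (Pushout.inl _ _ a), fun e => w (Sum.inl e), h.inp, fun _ => rfl,
        fun e => h.law (Sum.inl e), fun e => h.src (Sum.inl e), fun e => h.tgt (Sum.inl e),
        fun q => ?_⟩,
      ⟨fun b => ψ (Pushout.inr _ _ b), fun e => w (Sum.inr e), fun y => ?_, h.out,
        fun e => h.law (Sum.inr e), fun e => h.src (Sum.inr e), fun e => h.tgt (Sum.inr e),
        fun q => ?_⟩⟩
    · have := LinearMap.congr_fun hJ q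
      simp only [LinearMap.sub_apply, LinearMap.add_apply] at this
      linear_combination this
    · exact congrArg ψ (Pushout.glue _ _ y)
    · have := LinearMap.congr_fun hJ' q
      simp only [LinearMap.sub_apply, LinearMap.add_apply] at this
      linear_combination -this
  · rintro ⟨x, ⟨ψ, w, h⟩, ⟨ψ', w', h'⟩⟩
    refine ⟨Pushout.desc ψ ψ' fun y => (h.out y).symm.trans (h'.inp y), Sum.elim w w', h.inp,
      h'.out, ?_, ?_, ?_, fun q => ?_⟩
    · rintro (e | e)
      · exact h.law e
      · exact h'.law e
    · rintro (e | e)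
      · exact h.src e
      · exact h'.src e
    · rintro (e | e)
      · exact h.tgt e
      · exact h'.tgt e
    · refine (conserved_comp_iff c d u v (Sum.elim w w') q).2 ?_
      have e1 := h.conserved fun a => q (Pushout.inl _ _ a)
      have e2 := h'.conserved fun a => q (Pushout.inr _ _ a)
      -- Both ends of a wire are the same node of the pushout, so its current leaves `c` and enters
      -- `d` with the same weight.
      have e3 : charge c.out (fun y => (x y).2) (fun a => q (Pushout.inl c.out d.inp a)) =
          charge d.inp (fun y => (x y).2) (fun a => q (Pushout.inr c.out d.inp a)) :=
        congrArg (fun f => charge f (fun y => (x y).2) q) (funext (Pushout.glue c.out d.inp))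
      simp only [Sum.elim_inl, Sum.elim_inr]
      linear_combination e1 + e2 + e3

/-! ### Behaviour and tensor products -/

theorem conserved_tensor_iff (c : Circuit L (Fin m) (Fin n)) (d : Circuit L (Fin m') (Fin n'))
    (u : Fin (m + m') → k × k) (v : Fin (n + n') → k × k)
    (w : (c.tensor d).E → (Fin 1 → k × k) × (Fin 1 → k × k)) (q : (c.tensor d).N → k) :
    charge (c.tensor d).inp (fun x => (u x).2) q +
        charge (c.tensor d).tgt (fun e => ((w e).2 0).2) q =
      charge (c.tensor d).out (fun y => (v y).2) q +
        charge (c.tensor d).src (fun e => ((w e).1 0).2) q ↔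
    (charge c.inp (fun x => (u (Fin.castAdd m' x)).2) (fun a => q (Sum.inl a)) +
        charge c.tgt (fun e => ((w (Sum.inl e)).2 0).2) (fun a => q (Sum.inl a))) +
      (charge d.inp (fun x => (u (Fin.natAdd m x)).2) (fun a => q (Sum.inr a)) +
        charge d.tgt (fun e => ((w (Sum.inr e)).2 0).2) (fun a => q (Sum.inr a))) =
    (charge c.out (fun y => (v (Fin.castAdd n' y)).2) (fun a => q (Sum.inl a)) +
        charge c.src (fun e => ((w (Sum.inl e)).1 0).2) (fun a => q (Sum.inl a))) +
      (charge d.out (fun y => (v (Fin.natAdd n y)).2) (fun a => q (Sum.inr a)) +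
        charge d.src (fun e => ((w (Sum.inr e)).1 0).2) (fun a => q (Sum.inr a))) := by
  -- The legs of a tensor product are defined by cases on `Fin (i + j)`, not on a disjoint sum, so
  -- their charges are first split by position and then identified with charges on the two sets of
  -- nodes.
  have split : ∀ {i j : ℕ} (f : Fin (i + j) → (c.tensor d).N) (g : Fin i → c.N) (h : Fin j → d.N)
      (J : Fin (i + j) → k), (∀ x, f (Fin.castAdd j x) = Sum.inl (g x)) →
      (∀ x, f (Fin.natAdd i x) = Sum.inr (h x)) → charge f J q =
        charge g (fun x => J (Fin.castAdd j x)) (fun a => q (Sum.inl a)) +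
          charge h (fun x => J (Fin.natAdd i x)) (fun a => q (Sum.inr a)) := by
    intro i j f g h J hg hh
    rw [charge_fin_add, funext hg, funext hh]
    rfl
  rw [split _ _ _ _ (Circuit.tensor_inp_left c d) (Circuit.tensor_inp_right c d),
    split _ _ _ _ (Circuit.tensor_out_left c d) (Circuit.tensor_out_right c d),
    add_add_add_comm (charge c.inp _ _), add_add_add_comm (charge c.out _ _)]
  exact Iff.of_eq (congrArg₂ Eq (congrArg₂ (· + ·) rfl (charge_sum _ _ q))
    (congrArg₂ (· + ·) rfl (charge_sum _ _ q)))

theorem behaviour_tensor (c : Circuit L (Fin m) (Fin n)) (d : Circuit L (Fin m') (Fin n')) :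
    behaviour α (c.tensor d) = (RelProp (k × k)).tensor (behaviour α c) (behaviour α d) := by
  ext ⟨u, v⟩
  constructor
  · rintro ⟨ψ, w, h⟩
    refine ⟨⟨fun a => ψ (Sum.inl a), fun e => w (Sum.inl e), fun x => ?_, fun y => ?_,
        fun e => h.law (Sum.inl e), fun e => h.src (Sum.inl e), fun e => h.tgt (Sum.inl e),
        fun q => ?_⟩,
      ⟨fun b => ψ (Sum.inr b), fun e => w (Sum.inr e), fun x => ?_, fun y => ?_,
        fun e => h.law (Sum.inr e), fun e => h.src (Sum.inr e), fun e => h.tgt (Sum.inr e),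
        fun q => ?_⟩⟩
    · exact (h.inp _).trans (congrArg ψ (Circuit.tensor_inp_left c d x))
    · exact (h.out _).trans (congrArg ψ (Circuit.tensor_out_left c d y))
    · have := (conserved_tensor_iff c d u v w (Sum.elim q 0)).1 (h.conserved _)
      simpa [← Pi.zero_def] using this
    · exact (h.inp _).trans (congrArg ψ (Circuit.tensor_inp_right c d x))
    · exact (h.out _).trans (congrArg ψ (Circuit.tensor_out_right c d y))
    · have := (conserved_tensor_iff c d u v w (Sum.elim 0 q)).1 (h.conserved _)
      simpa [← Pi.zero_def] using this
  · rintro ⟨⟨ψ, w, h⟩, ⟨ψ', w', h'⟩⟩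
    refine ⟨Sum.elim ψ ψ', Sum.elim w w', fun x => ?_, fun x => ?_, ?_, ?_, ?_, fun q => ?_⟩
    · refine Fin.addCases (fun i => ?_) (fun i => ?_) x
      · rw [Circuit.tensor_inp_left]
        exact h.inp i
      · rw [Circuit.tensor_inp_right]
        exact h'.inp i
    · refine Fin.addCases (fun i => ?_) (fun i => ?_) x
      · rw [Circuit.tensor_out_left]
        exact h.out i
      · rw [Circuit.tensor_out_right]
        exact h'.out i
    · rintro (e | e)
      · exact h.law e
      · exact h'.law e
    · rintro (e | e)
      · exact h.src e
      · exact h'.src e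
    · rintro (e | e)
      · exact h.tgt e
      · exact h'.tgt e
    · exact (conserved_tensor_iff c d u v (Sum.elim w w') q).2
        (congrArg₂ (· + ·) (h.conserved _) (h'.conserved _))

/-! ### Behaviour of cospans and of single edges -/

/-- Without edges, only the boundary terms of the conservation law remain, and `mem_kRel_ker`
describes the relation of the corelation by potentials and test functions on the same nodes. Nodes
outside the image of the legs impose no condition, which is why the cospan matters only through its
kernel. -/
theorem behaviour_toCircuit (c : Cospan (Fin m) (Fin n)) :
    behaviour α (c.toCircuit L) = kRel k c.ker := by
  ext p
  rw [mem_kRel_ker]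
  have key : ∀ (w : (c.toCircuit L).E → (Fin 1 → k × k) × (Fin 1 → k × k))
      (q : (c.toCircuit L).N → k),
      charge (c.toCircuit L).inp (fun x => (p.1 x).2) q +
        charge (c.toCircuit L).tgt (fun e => ((w e).2 0).2) q =
      charge (c.toCircuit L).out (fun y => (p.2 y).2) q +
        charge (c.toCircuit L).src (fun e => ((w e).1 0).2) q ↔
      ∑ x, q (c.inp x) * (p.1 x).2 = ∑ y, q (c.out y) * (p.2 y).2 := fun w q => by
    rw [charge_of_isEmpty (c.toCircuit L).tgt, charge_of_isEmpty (c.toCircuit L).src, charge_apply,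
      charge_apply, add_zero, add_zero]
    rfl
  constructor
  · rintro ⟨ψ, w, h⟩
    refine ⟨⟨ψ, ?_⟩, fun q => (key w q).1 (h.conserved q)⟩
    · rintro (x | y)
      · exact h.inp x
      · exact h.out y
  · rintro ⟨⟨ψ, h⟩, h'⟩
    exact ⟨ψ, Empty.elim, fun x => h (Sum.inl x), fun y => h (Sum.inr y), fun e => e.elim,
      fun e => e.elim, fun e => e.elim, fun q => (key _ q).2 (h' q)⟩

/-- Each of the two nodes meets one boundary point and one end of the edge, so potentials and
currents there coincide and the boundary values are the state of the edge. -/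
theorem behaviour_edge (ℓ : L) : behaviour α (Circuit.edge ℓ) = α ℓ := by
  have hc : ∀ (p : (Fin 1 → k × k) × (Fin 1 → k × k))
      (w : Unit → (Fin 1 → k × k) × (Fin 1 → k × k)) (q : Bool → k),
      charge (Circuit.edge ℓ).inp (fun x => (p.1 x).2) q +
        charge (Circuit.edge ℓ).tgt (fun e => ((w e).2 0).2) q =
      charge (Circuit.edge ℓ).out (fun y => (p.2 y).2) q +
        charge (Circuit.edge ℓ).src (fun e => ((w e).1 0).2) q ↔
      q false * (p.1 0).2 + q true * ((w ()).2 0).2 =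
        q true * (p.2 0).2 + q false * ((w ()).1 0).2 := fun p w q => by
    have e1 : ∀ (f : Unit → Bool) (J : Unit → k), charge f J q = q (f ()) * J () := fun f J => by
      simp [charge_apply]
    have e2 : ∀ (f : Fin 1 → Bool) (J : Fin 1 → k), charge f J q = q (f 0) * J 0 := fun f J => by
      simp [charge_apply]
    exact Iff.of_eq (congrArg₂ Eq (congrArg₂ (· + ·) (e2 _ _) (e1 _ _))
      (congrArg₂ (· + ·) (e2 _ _) (e1 _ _)))
  ext p
  constructor
  · rintro ⟨ψ, w, h⟩
    -- The indicators of the two nodes as test potentials: `false` carries the input and the source,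
    -- `true` the output and the target.
    have hf := (hc p w fun b : Bool => bif b then 0 else 1).1 (h.conserved _)
    have ht := (hc p w fun b : Bool => bif b then 1 else 0).1 (h.conserved _)
    simp at hf ht
    have : p = w () := by
      refine Prod.ext (funext fun i => ?_) (funext fun i => ?_) <;>
        obtain rfl := Subsingleton.elim i 0
      · exact Prod.ext ((h.inp 0).trans (h.src ()).symm) hf
      · exact Prod.ext ((h.out 0).trans (h.tgt ()).symm) ht.symm
    rw [this]
    exact h.law ()
  · intro hp
    refine ⟨fun b : Bool => bif b then (p.2 0).1 else (p.1 0).1, fun _ => p, fun x => ?_, fun x => ?_,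
      fun _ => hp, fun _ => rfl, fun _ => rfl, fun q => (hc p (fun _ => p) q).2 (add_comm _ _)⟩
    · rw [Subsingleton.elim x 0]
      rfl
    · rw [Subsingleton.elim x 0]
      rfl

end Behaviour
/-! ### Circuits are generated by cospans and edges -/

section Generation

variable {L : Type u}

/-- An edge `ℓ` can be split off a circuit: the identity wires on the nodes next to the edge are
composed with the rest of the circuit, which has one more output, attached to the source of the
edge, and with a cospan that attaches the target of the edge. -/
theorem Circuit.iso_comp_edge {X Y N E : Type} {j : ℕ} [Finite N] [Finite E] (ν : Fin j ≃ N)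
    (inp : X → N) (out : Y → N) (src tgt : Option E → N) (lab : Option E → L) :
    Circuit.Iso
      { N := N, inp := inp, out := out, E := Option E, src := src, tgt := tgt, lab := lab }
      ((Circuit.mk
          (Cospan.mk N inp (Fin.addCases ν fun _ : Fin 1 => src none) : Cospan X (Fin (j + 1)))
          E (fun e => src (some e)) (fun e => tgt (some e)) (fun e => lab (some e))).comp
        (((Circuit.ofFun L (id : Fin j → Fin j)).tensor (Circuit.edge (lab none))).comp
          ((Cospan.mk N (Fin.addCases ν fun _ : Fin 1 => tgt none) out).toCircuit L))) := by
  let c : Circuit L X (Fin (j + 1)) :=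
    Circuit.mk
      (Cospan.mk N inp (Fin.addCases ν fun _ : Fin 1 => src none) : Cospan X (Fin (j + 1)))
      E (fun e => src (some e)) (fun e => tgt (some e)) (fun e => lab (some e))
  let t := (Circuit.ofFun L (id : Fin j → Fin j)).tensor (Circuit.edge (lab none))
  let d : Circuit L (Fin (j + 1)) Y :=
    (Cospan.mk N (Fin.addCases ν fun _ : Fin 1 => tgt none) out).toCircuit L
  change Circuit.Iso _ (c.comp (t.comp d))
  have hc : ∀ i : Fin j, c.out (Fin.castAdd 1 i) = ν i := fun i =>
    Fin.addCases_left (motive := fun _ => N) (left := ν)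
      (right := fun _ : Fin 1 => src none) i
  have hc' : ∀ i : Fin 1, c.out (Fin.natAdd j i) = src none := fun i =>
    Fin.addCases_right (motive := fun _ => N) (left := ν)
      (right := fun _ : Fin 1 => src none) i
  have hd : ∀ i : Fin j, d.inp (Fin.castAdd 1 i) = ν i := fun i =>
    Fin.addCases_left (motive := fun _ => N) (left := ν)
      (right := fun _ : Fin 1 => tgt none) i
  have hd' : ∀ i : Fin 1, d.inp (Fin.natAdd j i) = tgt none := fun i =>
    Fin.addCases_right (motive := fun _ => N) (left := ν)
      (right := fun _ : Fin 1 => tgt none) i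
  have ht := fun i => Circuit.tensor_inp_left (Circuit.ofFun L (id : Fin j → Fin j))
    (Circuit.edge (lab none)) i
  have ht' := fun i => Circuit.tensor_inp_right (Circuit.ofFun L (id : Fin j → Fin j))
    (Circuit.edge (lab none)) i
  have hu := fun i => Circuit.tensor_out_left (Circuit.ofFun L (id : Fin j → Fin j))
    (Circuit.edge (lab none)) i
  have hu' := fun i => Circuit.tensor_out_right (Circuit.ofFun L (id : Fin j → Fin j))
    (Circuit.edge (lab none)) i
  -- `a`, `b`, `b'` include the nodes of the three factors into the iterated pushout. The relations
  -- `g1` and `g3` pass along the wires, so that by surjectivity of `ν` the outer copies of `N`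
  -- coincide (`g5`); `g2` and `g4` attach the two ends of the edge to its source and target.
  let a : N → (c.comp (t.comp d)).N := Pushout.inl c.out (t.comp d).inp
  let b : Fin j ⊕ Bool → (c.comp (t.comp d)).N := fun x =>
    Pushout.inr c.out (t.comp d).inp (Pushout.inl t.out d.inp x)
  let b' : N → (c.comp (t.comp d)).N := fun x =>
    Pushout.inr c.out (t.comp d).inp (Pushout.inr t.out d.inp x)
  have g1 : ∀ i, a (ν i) = b (Sum.inl i) := fun i => by
    have := Pushout.glue c.out (t.comp d).inp (Fin.castAdd 1 i)
    rw [hc] at this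
    exact this.trans (congrArg b (ht i))
  have g2 : a (src none) = b (Sum.inr false) := by
    have := Pushout.glue c.out (t.comp d).inp (Fin.natAdd j 0)
    rw [hc'] at this
    exact this.trans (congrArg b (ht' 0))
  have g3 : ∀ i, b (Sum.inl i) = b' (ν i) := fun i => by
    have := Pushout.glue t.out d.inp (Fin.castAdd 1 i)
    rw [hd] at this
    exact (congrArg b (hu i)).symm.trans (congrArg (Pushout.inr c.out (t.comp d).inp) this)
  have g4 : b (Sum.inr true) = b' (tgt none) := by
    have := Pushout.glue t.out d.inp (Fin.natAdd j 0)
    rw [hd'] at this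
    exact (congrArg b (hu' 0)).symm.trans (congrArg (Pushout.inr c.out (t.comp d).inp) this)
  have g5 : ∀ x, a x = b' x := fun x => by
    obtain ⟨i, rfl⟩ := ν.surjective x
    exact (g1 i).trans (g3 i)
  -- The map back to `N` on the middle factor. Together with the identity on the outer copies of `N`
  -- it respects both gluings (`r1`, `r2`), so it defines a retraction of `a`: no two distinct nodes
  -- of the original circuit get identified.
  let β : t.N → N := Sum.elim ν fun s => bif s then tgt none else src none
  have r1 : ∀ y, β (t.out y) = d.inp y := fun y => by
    refine Fin.addCases (fun i => ?_) (fun i => ?_) y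
    · exact (congrArg β (hu i)).trans (hd i).symm
    · exact (congrArg β (hu' i)).trans (hd' i).symm
  have r2 : ∀ y, c.out y = β (t.inp y) := fun y => by
    refine Fin.addCases (fun i => ?_) (fun i => ?_) y
    · exact (hc i).trans (congrArg β (ht i)).symm
    · exact (hc' i).trans (congrArg β (ht' i)).symm
  -- The inverse on nodes is the retraction built from `β`. On edges, `none` is the edge of the
  -- middle factor, the other edges belong to the first factor, and all remaining summands are
  -- empty.
  refine ⟨⟨a, Pushout.desc id (Pushout.desc β id r1) r2, fun _ => rfl, ?_⟩,
    ⟨fun e => e.elim (Sum.inr (Sum.inl (Sum.inr ()))) Sum.inl,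
      Sum.elim some (Sum.elim (fun _ => none) Empty.elim), ?_, ?_⟩,
    fun _ => rfl, fun y => g5 (out y), ?_, ?_, ?_⟩
  · refine Pushout.ind (fun _ => rfl) (Pushout.ind ?_ g5)
    rintro (i | _ | _)
    · exact g1 i
    · exact g2
    · exact (g5 _).trans g4.symm
  · rintro (_ | e) <;> rfl
  · rintro (e | (e | e) | e)
    · rfl
    · exact e.elim
    · rfl
    · exact e.elim
  · rintro (_ | e)
    · exact g2
    · rfl
  · rintro (_ | e)
    · exact (g5 _).trans g4.symm
    · rfl
  · rintro (_ | e) <;> rfl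

/-- A property of morphisms of `Circ L` that holds for cospans and edges, and is preserved by
composition and tensor products, holds for all morphisms. -/
theorem Circ.induction {p : ∀ {m n : ℕ}, (Circ L).Hom m n → Prop}
    (hcospan : ∀ {m n : ℕ} (c : FinCospan.Hom m n), p ((FinCospan.toCirc L).map c))
    (hedge : ∀ ℓ : L, p (Circ.edge ℓ))
    (hcomp : ∀ {l m n : ℕ} (f : (Circ L).Hom l m) (g : (Circ L).Hom m n),
      p f → p g → p ((Circ L).comp f g))
    (htensor : ∀ {m n m' n' : ℕ} (f : (Circ L).Hom m n) (g : (Circ L).Hom m' n'),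
      p f → p g → p ((Circ L).tensor f g)) {m n : ℕ} (f : (Circ L).Hom m n) : p f := by
  have hc : ∀ {m n : ℕ} (c : Cospan (Fin m) (Fin n)),
      p (m := m) (n := n) (Quotient.mk _ (c.toCircuit L)) := fun c => hcospan (Quotient.mk _ c)
  have hcongr : ∀ {m n : ℕ} {c d : Circuit L (Fin m) (Fin n)}, Circuit.Iso c d →
      p (m := m) (n := n) (Quotient.mk _ d) → p (m := m) (n := n) (Quotient.mk _ c) := by
    intro m n c d h hd
    rwa [show (Quotient.mk _ c : (Circ L).Hom m n) = Quotient.mk _ d from Quotient.sound h]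
  -- The induction is on the set of edges alone; boundary, nodes and structure maps stay arbitrary,
  -- because removing an edge adds an output.
  have key : ∀ (E : Type) [Finite E], ∀ [Finite E] (m n : ℕ) (N : Type) [Finite N] (inp : Fin m → N)
      (out : Fin n → N) (src tgt : E → N) (lab : E → L), p (m := m) (n := n) (Quotient.mk _
        { N := N, inp := inp, out := out, E := E, src := src, tgt := tgt, lab := lab }) := by
    intro E hE
    induction E using Finite.induction_empty_option with
    | of_equiv g ih =>
      intro _ m n N hN inp out src tgt lab
      have := Finite.of_equiv _ g.symm
      refine hcongr (d := ⟨⟨N, inp, out⟩, _, fun e => src (g e), fun e => tgt (g e),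
        fun e => lab (g e)⟩) ?_ (ih _ _ _ _ _ _ _ _)
      exact ⟨Equiv.refl _, g.symm, fun _ => rfl, fun _ => rfl, fun e => by simp, fun e => by simp,
        fun e => by simp⟩
    | h_empty =>
      intro _ m n N hN inp out src tgt lab
      refine hcongr ?_ (hc ⟨N, inp, out⟩)
      exact ⟨Equiv.refl _, Equiv.equivOfIsEmpty PEmpty Empty, fun _ => rfl, fun _ => rfl,
        fun e => e.elim, fun e => e.elim, fun e => e.elim⟩
    | h_option ih =>
      intro _ m n N hN inp out src tgt lab
      -- Numbering the nodes lets each of them serve as a wire in the decomposition; the first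
      -- factor has one edge less, and the others are cospans and an edge.
      obtain ⟨j, ⟨ν⟩⟩ : ∃ j, Nonempty (N ≃ Fin j) := Finite.exists_equiv_fin N
      refine hcongr (Circuit.iso_comp_edge ν.symm inp out src tgt lab) ?_
      exact hcomp _ _ (ih _ _ _ _ _ _ _ _) (hcomp _ _ (htensor _ _ (hc _) (hedge _)) (hc _))
  obtain ⟨⟨⟨N, inp, out⟩, E, src, tgt, lab⟩⟩ := f
  exact key E m n N inp out src tgt lab

end Generation
-- The black-boxing morphism and its uniqueness
section BlackBox

variable {k : Type u} [Field k] {L : Type v} {m n : ℕ}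

/-- The behaviour of an isomorphism class of circuits. -/
def behaviourClass (α : L → Set ((Fin 1 → k × k) × (Fin 1 → k × k))) :
    (Circ L).Hom m n → Set ((Fin m → k × k) × (Fin n → k × k)) :=
  Quotient.lift (behaviour α) fun _ _ h => behaviour_congr h

theorem behaviourClass_toCirc (α : L → Set ((Fin 1 → k × k) × (Fin 1 → k × k)))
    (c : FinCospan.Hom m n) :
    behaviourClass α ((FinCospan.toCirc L).map c) = (((K k).comp H).map c).1 := by
  obtain ⟨c⟩ := c
  exact behaviour_toCircuit c

/-- No dimension count on the equations of a circuit is needed. Cospans give linear Lagrangian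
relations, edges give the prescribed ones, and Lagrangian affine relations are closed under
composition and tensor product; `Circ.induction` does the rest. The empty relation can occur, when
the laws of the edges are incompatible. -/
theorem isAffLag_behaviourClass (α : L → (AffLagRel k).Hom 1 1) (f : (Circ L).Hom m n) :
    IsAffLag (behaviourClass (fun ℓ => (α ℓ).1) f) := by
  refine Circ.induction (p := fun f => IsAffLag (behaviourClass (fun ℓ => (α ℓ).1) f))
    (fun c => ?_) (fun ℓ => ?_) ?_ ?_ f
  · exact Eq.mpr (congrArg IsAffLag (behaviourClass_toCirc _ c)) (((K k).comp H).map c).2.affine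
  · exact Eq.mpr (congrArg IsAffLag (behaviour_edge (α := fun ℓ => (α ℓ).1) ℓ)) (α ℓ).2
  · rintro _ _ _ ⟨c⟩ ⟨d⟩ hc hd
    exact Eq.mpr (congrArg IsAffLag (behaviour_comp c d)) (isAffLag_comp _ _ hc hd)
  · rintro _ _ _ _ ⟨c⟩ ⟨d⟩ hc hd
    exact Eq.mpr (congrArg IsAffLag (behaviour_tensor c d)) (isAffLag_tensor _ _ hc hd)

/-- The morphism of props that sends a circuit to its behaviour. -/
def blackBox (α : L → (AffLagRel k).Hom 1 1) : PROPHom (Circ L) (AffLagRel k) where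
  map f := ⟨behaviourClass (fun ℓ => (α ℓ).1) f, isAffLag_behaviourClass α f⟩
  -- Identities, and likewise the braidings below, are cospans; there the behaviour is given by `K`
  -- after `H`, which preserves them.
  map_id n := Subtype.ext ((behaviourClass_toCirc _ (FinCospan.id n)).trans
    (congrArg Subtype.val (((K k).comp H).map_id n)))
  map_comp := by
    rintro _ _ _ ⟨c⟩ ⟨d⟩
    exact Subtype.ext (behaviour_comp c d)
  map_tensor := by
    rintro _ _ _ _ ⟨c⟩ ⟨d⟩
    exact Subtype.ext (behaviour_tensor c d)
  map_braid m n := Subtype.ext ((behaviourClass_toCirc _ (FinCospan.braid m n)).trans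
    (congrArg Subtype.val (((K k).comp H).map_braid m n)))

/-- Morphisms of props out of `Circ L` are determined by their values on cospans and edges. -/
theorem Circ.hom_ext {Q : PROP.{w}} {F G : PROPHom (Circ L) Q}
    (h : F.comp (FinCospan.toCirc L) = G.comp (FinCospan.toCirc L))
    (h' : ∀ ℓ : L, F.map (Circ.edge ℓ) = G.map (Circ.edge ℓ)) : F = G := by
  have key : ∀ {m n : ℕ} (f : (Circ L).Hom m n), F.map f = G.map f := by
    intro m n f
    refine Circ.induction (p := fun f => F.map f = G.map f) (fun {m n} c => ?_) h' ?_ ?_ f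
    · exact congrArg (fun F : PROPHom FinCospan Q => F.map c) h
    · intro l m n f g hf hg
      rw [F.map_comp, G.map_comp, hf, hg]
    · intro m n m' n' f g hf hg
      rw [F.map_tensor, G.map_tensor, hf, hg]
  refine PROPHom.ext ?_
  funext m n f
  exact key f

end BlackBox

end Circuits

theorem mainTheorem5 {k : Type u} [Field k] {L : Type v}
    (α : L → (Circuits.AffLagRel k).Hom 1 1) :
    ∃! B : Circuits.PROPHom (Circuits.Circ L) (Circuits.AffLagRel k),
      B.comp (Circuits.FinCospan.toCirc L) =
        (Circuits.LagRel.toAffLagRel k).comp ((Circuits.K k).comp Circuits.H) ∧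
      ∀ ℓ : L, B.map (Circuits.Circ.edge ℓ) = α ℓ := by
  have h1 : (Circuits.blackBox α).comp (Circuits.FinCospan.toCirc L) =
      (Circuits.LagRel.toAffLagRel k).comp ((Circuits.K k).comp Circuits.H) := by
    refine Circuits.PROPHom.ext ?_
    funext m n c
    exact Subtype.ext (Circuits.behaviourClass_toCirc _ c)
  have h2 : ∀ ℓ : L, (Circuits.blackBox α).map (Circuits.Circ.edge ℓ) = α ℓ := fun ℓ =>
    Subtype.ext (Circuits.behaviour_edge ℓ)
  -- Any other solution agrees with `blackBox` on cospans and on edges, and these generate all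
  -- circuits.
  exact ⟨Circuits.blackBox α, ⟨h1, h2⟩, fun B hB =>
    Circuits.Circ.hom_ext (hB.1.trans h1.symm) fun ℓ => (hB.2 ℓ).trans (h2 ℓ).symm⟩
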